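/- Let $\Lambda$ be a nontrivial finitely generated torsion-free nilpotent group, let $d\ge 1$, and let $\Gamma=\mathbb Z^d\wr\Lambda=\big(\bigoplus_{\Lambda}\mathbb Z^d\big)\rtimes\Lambda$ be the wreath product, where $\Lambda$ acts on the direct sum by shifting the copies of $\mathbb Z^d$. Then $\Gamma$ is amenable and admits an action by homeomorphisms on the Cantor space $X$ (in particular, on a finite-dimensional compact metrizable space) such that: 1. the action is minimal (every orbit is dense) and topologically free (the set of points with trivial stabilizer is comeager); 2. the action has exactly one invariant Borel probability measure, which is therefore the unique invariant ergodic measure; in particular it has finitely many invariant ergodic measures; 3. the action has dynamical comparison: for all nonempty clopen sets $A,B\subseteq X$ with $\mu(A)<\mu(B)$ for every $\Gamma$-invariant Borel probability measure $\mu$, there are a partition $A=\bigsqcup_{i=1}^n C_i$ into clopen sets and $\gamma_1,\dots,\gamma_n\in\Gamma$ such that the sets $\gamma_iC_i$ are pairwise disjoint subsets of $B$; 4. the action is not almost finite. Here an action of $\Gamma$ on a zero-dimensional compact metrizable space $X$ is almost finite if for every nonempty finite $K\subseteq\Gamma$ and every $\varepsilon>0$ there are clopen sets $V_1,\dots,V_n\subseteq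 X$ and finite sets $S_1,\dots,S_n\subseteq\Gamma$ such that the sets $sV_i$ ($1\le i\le n$, $s\in S_i$) are pairwise disjoint with union $X$, and $|KS_i\mathbin{\triangle}S_i|<\varepsilon|S_i|$ for all $i$. Consequently, the equivalence of almost finiteness and dynamical comparison (proved by Kerr for free actions, as part of his dynamical version of the Toms–Winter conjecture) fails for topologically free actions: it is not true that for every minimal, topologically free action of a countable amenable group on a nonempty zero-dimensional compact metrizable space with finitely many invariant ergodic probability measures, the action is almost finite if and only if it has dynamical comparison. -/

import Mathlib

open scoped Pointwise

universe u

/-- The action of `Λ` on `⨁_Λ A` (finitely supported functions `Λ → A`, written multiplicatively)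
by shifting the copies of `A`: `(γ · f)(μ) = f(γ⁻¹ μ)`. -/
noncomputable def shiftHom (A Λ : Type*) [AddCommGroup A] [Group Λ] :
    Λ →* MulAut (Multiplicative (Λ →₀ A)) where
  toFun γ := AddEquiv.toMultiplicative (Finsupp.domCongr (Equiv.mulLeft γ))
  map_one' := by
    refine MulEquiv.ext fun f => Multiplicative.toAdd.injective (Finsupp.ext fun a => ?_)
    change (Multiplicative.toAdd f) ((1 : Λ)⁻¹ * a) = (Multiplicative.toAdd f) a
    simp
  map_mul' γ δ := by
    refine MulEquiv.ext fun f => Multiplicative.toAdd.injective (Finsupp.ext fun a => ?_)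
    change (Multiplicative.toAdd f) ((γ * δ)⁻¹ * a) = (Multiplicative.toAdd f) (δ⁻¹ * (γ⁻¹ * a))
    simp [mul_assoc]

theorem shiftHom_apply {A Λ : Type*} [AddCommGroup A] [Group Λ]
    (γ : Λ) (f : Multiplicative (Λ →₀ A)) (a : Λ) :
    (Multiplicative.toAdd (shiftHom A Λ γ f)) a = (Multiplicative.toAdd f) (γ⁻¹ * a) := by
  simp [shiftHom, Finsupp.equivMapDomain_apply]

/-- The (restricted) wreath product `A ≀ Λ = (⨁_Λ A) ⋊ Λ` of an abelian group `A` by `Λ`,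
with product `(f, γ) (f', γ') = (f + f'(γ⁻¹ ·), γ γ')`. -/
abbrev WreathProduct (A Λ : Type*) [AddCommGroup A] [Group Λ] : Type _ :=
  Multiplicative (Λ →₀ A) ⋊[shiftHom A Λ] Λ

open Classical in
/-- Amenability of a discrete group, through the Følner condition. -/
def IsAmenable (Γ : Type*) [Group Γ] : Prop :=
  ∀ (K : Finset Γ) (ε : ℝ), K.Nonempty → 0 < ε →
    ∃ S : Finset Γ, S.Nonempty ∧ ((symmDiff (K * S) S).card : ℝ) < ε * (S.card : ℝ)

/-- The set of points with trivial stabilizer is comeager. -/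
def IsTopologicallyFree (Γ X : Type*) [Group Γ] [MulAction Γ X] [TopologicalSpace X] : Prop :=
  {x : X | MulAction.stabilizer Γ x = ⊥} ∈ residual X

/-- The `Γ`-invariant Borel probability measures on `X`. -/
def invariantMeasures (Γ X : Type*) [Group Γ] [MulAction Γ X] [MeasurableSpace X] :
    Set (MeasureTheory.Measure X) :=
  {μ | MeasureTheory.IsProbabilityMeasure μ ∧ MeasureTheory.SMulInvariantMeasure Γ X μ}

/-- The ergodic `Γ`-invariant Borel probability measures on `X`. -/
def ergodicMeasures (Γ X : Type*) [Group Γ] [MulAction Γ X] [MeasurableSpace X] :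
    Set (MeasureTheory.Measure X) :=
  {μ | MeasureTheory.IsProbabilityMeasure μ ∧ ErgodicSMul Γ X μ}

open Classical in
/-- Almost finiteness of an action on a zero-dimensional compact metrizable space. -/
def IsAlmostFinite (Γ X : Type*) [Group Γ] [MulAction Γ X] [TopologicalSpace X] : Prop :=
  ∀ (K : Finset Γ) (ε : ℝ), K.Nonempty → 0 < ε →
    ∃ (n : ℕ) (V : Fin n → Set X) (S : Fin n → Finset Γ),
      (∀ i, IsClopen (V i)) ∧
      (∀ i j, ∀ s ∈ S i, ∀ t ∈ S j, (i, s) ≠ (j, t) → Disjoint (s • V i) (t • V j)) ∧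
      (∀ i, ((symmDiff (K * S i) (S i)).card : ℝ) < ε * ((S i).card : ℝ)) ∧
      (⋃ i, ⋃ s ∈ S i, s • V i) = Set.univ

/-- Dynamical comparison of an action on a zero-dimensional compact metrizable space. -/
def HasComparison (Γ X : Type*) [Group Γ] [MulAction Γ X] [TopologicalSpace X]
    [MeasurableSpace X] : Prop :=
  ∀ A B : Set X, IsClopen A → IsClopen B → A.Nonempty → B.Nonempty →
    (∀ μ ∈ invariantMeasures Γ X, μ A < μ B) →
    ∃ (n : ℕ) (C : Fin n → Set X) (γ : Fin n → Γ),
      (∀ i, IsClopen (C i)) ∧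
      (Pairwise fun i j => Disjoint (C i) (C j)) ∧
      (⋃ i, C i) = A ∧
      (Pairwise fun i j => Disjoint (γ i • C i) (γ j • C j)) ∧
      (∀ i, γ i • C i ⊆ B)

/-- The equivalence between almost finiteness and comparison of the dynamical Toms–Winter
conjecture, for all minimal topologically free actions (by homeomorphisms) of countable amenable
groups on zero-dimensional compact metrizable spaces with finitely many ergodic measures. -/
def TopologicallyFreeTomsWinter : Prop :=
  ∀ (Γ : Type u) [Group Γ] [Countable Γ]
    (X : Type) [TopologicalSpace X] [CompactSpace X] [TopologicalSpace.MetrizableSpace X]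
    [TotallyDisconnectedSpace X] [Nonempty X] [MeasurableSpace X] [BorelSpace X]
    [MulAction Γ X] [ContinuousConstSMul Γ X],
    IsAmenable Γ → MulAction.IsMinimal Γ X → IsTopologicallyFree Γ X →
    (ergodicMeasures Γ X).Finite →
    (IsAlmostFinite Γ X ↔ HasComparison Γ X)

/-!
The action is an odometer: for a decreasing chain of finite-index subgroups `H n` of `Γ = ℤ^d ≀ Λ`
with trivial intersection, `Γ` acts on the inverse limit of the coset spaces `Γ ⧸ H n`, which is a
Cantor space. As `Γ` permutes the cosets of each `H n` transitively, an odometer is minimal, all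
the fibres over `Γ ⧸ H n` have the same mass for an invariant probability measure, so that this
measure is unique, and it has comparison: clopen sets are unions of fibres over a common
`Γ ⧸ H n`, and the fibres in the set of smaller measure can be moved one by one into distinct fibres
in the other set. The base point has trivial stabilizer, and since its orbit is dense, no `g ≠ 1`
fixes a nonempty open set; thus the action is topologically free.

What remains is to choose the chain so that some `g ≠ 1` fixes a set of positive measure. Almost
finiteness then fails (`not_isAlmostFinite_of_fixedPoints`), because in a tower decomposition the
fixed points of `g` lie on the `g`-boundaries of the shapes, whose total measure is less than any
`ε > 0`. Let `N m` be finite-index normal subgroups of `Λ` that separate more and more points, and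
`E m` finite sets increasing to `Λ`, with `(E m).card` small compared to the index of `N m`. Let
`H n` be the intersection of finitely many of the subgroups
`wreathSubgroup (N m) (E m) (2 ^ m ℤ^d)` of the `(f, γ)` with `γ ∈ N m` for which the sums
of `f` over the cosets `x N m`, `x ∈ E m`, are divisible by `2 ^ m`. Every `f ≠ 0` eventually
violates one of these conditions, so the intersection is trivial. But an `f` supported at one point is constrained at stage `m` only if
this point lies in one of the few cosets `x N m`; the proportion of conjugates of `f` for which
this happens at some stage is at most `1 / 2`, and so is the measure of the set of points moved by
`f` (`measure_fixedPoints_ne_zero`).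

The subgroups `N m` exist because finitely generated nilpotent groups are residually finite
(`residuallyFinite_of_isNilpotent`), and torsion-freeness makes `Λ` infinite. Amenability follows
from closure under extensions (`isAmenable_of_extension`).
-/

/-! ### The Cantor space as an inverse limit of finite sets -/

theorem continuous_of_head_tail {Z : Type*} [TopologicalSpace Z] {f : Bool → (ℕ → Bool) → Z}
    (hf : ∀ b, Continuous (f b)) :
    Continuous fun x : ℕ → Bool => f (x 0) (fun n => x (n + 1)) := by
  have h : Continuous fun p : Bool × (ℕ → Bool) => f p.1 p.2 :=
    continuous_prod_of_discrete_left.2 hf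
  have h' : Continuous fun x : ℕ → Bool => (x 0, fun n => x (n + 1)) :=
    (continuous_apply 0).prodMk (continuous_pi fun n => continuous_apply (n + 1))
  exact h.comp h'

/-- The unary code `0, 10, 110, …, 1…10, 1…11` splits the Cantor space: `d x` is the letter encoded
by the code word that begins `x`, and `t x` is what remains of `x` after this code word. -/
theorem exists_cantor_split (m : ℕ) :
    ∃ (d : (ℕ → Bool) → Fin (m + 2)) (t : (ℕ → Bool) → (ℕ → Bool)),
      Continuous d ∧ Continuous t ∧ (∀ i s, ∃ x, d x = i ∧ t x = s) ∧
      ∀ k x y, d x = d y → (∀ j < k, t x j = t y j) → ∀ j < k + 1, x j = y j := by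
  induction m with
  | zero =>
    refine ⟨fun x => bif x 0 then 1 else 0, fun x n => x (n + 1), ?_, ?_, ?_, ?_⟩
    · exact (continuous_of_discreteTopology
        (f := fun b : Bool => (bif b then 1 else 0 : Fin 2))).comp (continuous_apply 0)
    · exact continuous_pi fun n => continuous_apply (n + 1)
    · intro i s
      refine ⟨fun n => n.casesOn (i == 1) s, ?_, rfl⟩
      fin_cases i <;> rfl
    · intro k x y h0 h j hj
      rcases j with _ | j
      · cases hx : x 0 <;> cases hy : y 0 <;> simp_all
      · exact h j (by omega)
  | succ m ih =>
    obtain ⟨d, t, hd, ht, hs, hi⟩ := ih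
    refine ⟨fun x => bif x 0 then (d fun n => x (n + 1)).succ else 0,
      fun x => bif x 0 then t fun n => x (n + 1) else fun n => x (n + 1), ?_, ?_, ?_, ?_⟩
    · refine continuous_of_head_tail (f := fun b x => bif b then (d x).succ else 0) ?_
      rintro (_ | _)
      · exact continuous_const
      · exact (continuous_of_discreteTopology (f := Fin.succ)).comp hd
    · refine continuous_of_head_tail (f := fun b x => bif b then t x else x) ?_
      rintro (_ | _)
      · exact continuous_id
      · exact ht
    · intro i s
      refine Fin.cases ?_ (fun i => ?_) i
      · exact ⟨fun n => n.casesOn false s, rfl, rfl⟩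
      · obtain ⟨x, hx, hx'⟩ := hs i s
        refine ⟨fun n => n.casesOn true x, ?_, ?_⟩
        · exact congrArg Fin.succ hx
        · exact hx'
    · intro k x y h0 h j hj
      cases hx : x 0 <;> cases hy : y 0 <;> simp only [hx, hy, cond_true, cond_false] at h0 h
      · rcases j with _ | j
        · rw [hx, hy]
        · exact h j (by omega)
      · exact absurd h0.symm (Fin.succ_ne_zero _)
      · exact absurd h0 (Fin.succ_ne_zero _)
      · rcases j with _ | j
        · rw [hx, hy]
        · exact hi k _ _ (Fin.succ_injective _ h0) h j (by omega)

/-- A product of finite sets with at least two points each is a Cantor space: concatenating unary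
code words identifies it with the space of binary sequences. -/
theorem exists_homeomorph_pi_fin (k : ℕ → ℕ) :
    Nonempty ((ℕ → Bool) ≃ₜ ∀ n, Fin (k n + 2)) := by
  choose d t hd ht hs hi using exists_cantor_split
  let s : ℕ → (ℕ → Bool) → (ℕ → Bool) := fun n => Nat.rec id (fun n f => t (k n) ∘ f) n
  have s_succ (n x) : s (n + 1) x = t (k n) (s n x) := rfl
  have hsc (n) : Continuous (s n) := by
    induction n with
    | zero => exact continuous_id
    | succ n ih => exact (ht (k n)).comp ih
  have hdc (n) : Continuous fun x => d (k n) (s n x) := (hd _).comp (hsc n)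
  let f : (ℕ → Bool) → ∀ n, Fin (k n + 2) := fun x n => d (k n) (s n x)
  have hf : Continuous f := continuous_pi hdc
  have hinj : Function.Injective f := by
    intro x y hxy
    -- Equal letters and tails that agree on `l` digits force agreement on `l + n` digits.
    have key (n) : ∀ l, (∀ j < l, s n x j = s n y j) → ∀ j < l + n, x j = y j := by
      induction n with
      | zero => exact fun l h => h
      | succ n ih =>
        intro l h j hj
        exact ih (l + 1) (hi (k n) l _ _ (congrFun hxy n) h) j (by omega)
    funext j
    exact key (j + 1) 0 (by simp) j (by omega)
  have hsurj : Function.Surjective f := by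
    intro y
    have hne (n) : ∀ z, ∃ x, s n x = z ∧ ∀ i < n, f x i = y i := by
      induction n with
      | zero => exact fun z => ⟨z, rfl, by simp⟩
      | succ n ih =>
        intro z
        obtain ⟨w, hw, hw'⟩ := hs (k n) (y n) z
        obtain ⟨x, hx, hx'⟩ := ih w
        refine ⟨x, by rw [s_succ, hx, hw'], fun i hi => ?_⟩
        rcases Nat.lt_succ_iff_lt_or_eq.1 hi with h | rfl
        · exact hx' i h
        · change d (k i) (s i x) = _
          rw [hx, hw]
    have hclosed (n) : IsClosed {x | ∀ i < n, f x i = y i} := by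
      simp only [Set.ofPred_forall]
      exact isClosed_iInter fun i => isClosed_iInter fun _ =>
        isClosed_eq (hdc i) continuous_const
    obtain ⟨x, hx⟩ := IsCompact.nonempty_iInter_of_sequence_nonempty_isCompact_isClosed
      (fun n => {x | ∀ i < n, f x i = y i}) (fun n x hx i hi => hx i (by omega))
      (fun n => (hne n fun _ => false).imp fun x hx => hx.2) (hclosed 0).isCompact hclosed
    rw [Set.mem_iInter] at hx
    exact ⟨x, funext fun n => hx (n + 1) n (by omega)⟩
  exact ⟨Continuous.homeoOfEquivCompactToT2 (f := Equiv.ofBijective f ⟨hinj, hsurj⟩) hf⟩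

open MeasureTheory in
/-- The Cantor space as the inverse limit of a tower of finite sets `Q n`, in which every point
of `Q n` has `k n + 2` preimages in `Q (n + 1)`, together with a probability measure that gives the
same mass to all the fibres over `Q n`. -/
theorem exists_cantor_tower (Q : ℕ → Type*) [Subsingleton (Q 0)] [Nonempty (Q 0)]
    (k : ℕ → ℕ) (φ : ∀ n, Q (n + 1) ≃ Q n × Fin (k n + 2)) :
    ∃ π : ∀ n, (ℕ → Bool) → Q n,
      (∀ n c, IsClopen (π n ⁻¹' {c})) ∧
      (∀ n x, (φ n (π (n + 1) x)).1 = π n x) ∧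
      (∀ x y, (∀ n, π n x = π n y) → x = y) ∧
      (∀ c : ∀ n, Q n, (∀ n, (φ n (c (n + 1))).1 = c n) → ∃ x, ∀ n, π n x = c n) ∧
      ∃ μ : Measure (ℕ → Bool), IsProbabilityMeasure μ ∧
        ∀ n c c', μ (π n ⁻¹' {c}) = μ (π n ⁻¹' {c'}) := by
  obtain ⟨e⟩ := exists_homeomorph_pi_fin k
  obtain ⟨c₀⟩ := ‹Nonempty (Q 0)›
  let ρ : ∀ n, (∀ n, Fin (k n + 2)) → Q n := fun n y =>
    Nat.rec c₀ (fun n c => (φ n).symm (c, y n)) n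
  have ρ_succ (n y) : φ n (ρ (n + 1) y) = (ρ n y, y n) := (φ n).apply_symm_apply _
  have ρ_eq (n) (y z) : ρ n y = ρ n z ↔ ∀ i < n, y i = z i := by
    induction n with
    | zero => simp [ρ]
    | succ n ih =>
      rw [← (φ n).injective.eq_iff, ρ_succ, ρ_succ, Prod.mk.injEq, ih, Nat.forall_lt_succ_right]
  have ρ_complete (c : ∀ n, Q n) (hc : ∀ n, (φ n (c (n + 1))).1 = c n) : ∃ y, ∀ n, ρ n y = c n := by
    refine ⟨fun n => (φ n (c (n + 1))).2, fun n => ?_⟩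
    induction n with
    | zero => exact Subsingleton.elim _ _
    | succ n ih =>
      apply (φ n).injective
      rw [ρ_succ, ih]
      exact Prod.ext (hc n).symm rfl
  have ρ_surj (n) : Function.Surjective (ρ n) := by
    induction n with
    | zero => exact fun c => ⟨fun _ => 0, Subsingleton.elim _ _⟩
    | succ n ih =>
      intro c
      obtain ⟨y, hy⟩ := ih (φ n c).1
      refine ⟨Function.update y n (φ n c).2, (φ n).injective ?_⟩
      rw [ρ_succ]
      refine Prod.ext ?_ (Function.update_self ..)
      rw [← hy]
      exact (ρ_eq n _ _).2 fun i hi => Function.update_of_ne hi.ne _ _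
  have fibre (n y) : ρ n ⁻¹' {ρ n y} = Set.pi (Finset.range n) fun i => {y i} := by
    ext z
    simp [ρ_eq, Set.mem_pi]
  let ν : Measure (∀ n, Fin (k n + 2)) :=
    Measure.infinitePi fun n => ProbabilityTheory.uniformOn Set.univ
  have : ∀ n, IsProbabilityMeasure
      (ProbabilityTheory.uniformOn (Set.univ : Set (Fin (k n + 2)))) := fun n =>
    ProbabilityTheory.isProbabilityMeasure_uniformOn Set.finite_univ Set.univ_nonempty
  refine ⟨fun n x => ρ n (e x), fun n c => ?_, fun n x => by simp [ρ_succ],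
    fun x y h => ?_, fun c hc => ?_, ν.map e.symm, ?_, fun n c c' => ?_⟩
  · obtain ⟨y, rfl⟩ := ρ_surj n c
    change IsClopen (e ⁻¹' (ρ n ⁻¹' {ρ n y}))
    rw [fibre]
    refine IsClopen.preimage ?_ e.continuous
    rw [Set.pi_def]
    exact (Finset.range n).finite_toSet.isClopen_biInter fun i _ =>
      (isClopen_discrete _).preimage (continuous_apply i)
  · refine e.injective (funext fun n => ?_)
    exact (ρ_eq (n + 1) _ _).1 (h (n + 1)) n n.lt_succ_self
  · obtain ⟨y, hy⟩ := ρ_complete c hc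
    exact ⟨e.symm y, fun n => by simp [hy]⟩
  · exact Measure.isProbabilityMeasure_map e.symm.continuous.measurable.aemeasurable
  · have key (y) : ν.map e.symm ((fun x => ρ n (e x)) ⁻¹' {ρ n y}) =
        ∏ i ∈ Finset.range n, ((k i + 2 : ℕ) : ENNReal)⁻¹ := by
      have : MeasurableSet (ρ n ⁻¹' {ρ n y}) := by
        rw [fibre]
        exact MeasurableSet.pi (Finset.range n).countable_toSet fun _ _ => measurableSet_singleton _
      have h : (fun x => ρ n (e x)) ∘ e.symm = ρ n := by ext; simp
      have hm : MeasurableSet ((fun x => ρ n (e x)) ⁻¹' {ρ n y}) := e.continuous.measurable this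
      rw [Measure.map_apply e.symm.continuous.measurable hm, ← Set.preimage_comp, h, fibre,
        Measure.infinitePi_pi _ (fun _ _ => measurableSet_singleton _)]
      refine Finset.prod_congr rfl fun i _ => ?_
      rw [ProbabilityTheory.uniformOn_univ]
      simp
    obtain ⟨y, rfl⟩ := ρ_surj n c
    obtain ⟨y', rfl⟩ := ρ_surj n c'
    rw [key, key]

/-! ### Odometers and their dynamical properties -/

section Odometer

open MeasureTheory

/-- Equivariant maps `π n : X → Γ ⧸ H n` with clopen fibres that separate the points of `X` and are
compatible with the projections between the coset spaces. On a compact space such maps present the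
action as the odometer (profinite action) of a chain of subgroups `H n`. -/
structure IsOdometer {Γ X : Type*} [Group Γ] [MulAction Γ X] [TopologicalSpace X]
    (H : ℕ → Subgroup Γ) (π : ∀ n, X → Γ ⧸ H n) : Prop where
  isClopen_fibre : ∀ n c, IsClopen (π n ⁻¹' {c})
  map_smul : ∀ n (g : Γ) (x : X), π n (g • x) = g • π n x
  map_mk : ∀ {m n : ℕ} {x : X} {γ : Γ}, m ≤ n → π n x = γ → π m x = γ
  separates : ∀ x y, (∀ n, π n x = π n y) → x = y

namespace IsOdometer

variable {Γ X : Type*} [Group Γ] [MulAction Γ X] [TopologicalSpace X]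
  {H : ℕ → Subgroup Γ} {π : ∀ n, X → Γ ⧸ H n}

theorem eq_of_le (h : IsOdometer H π) {m n : ℕ} {x y : X} (hmn : m ≤ n) (hxy : π n x = π n y) :
    π m x = π m y := by
  obtain ⟨γ, hγ⟩ := QuotientGroup.mk_surjective (π n y)
  rw [h.map_mk hmn (hxy.trans hγ.symm), h.map_mk hmn hγ.symm]

theorem exists_map_smul_iff (h : IsOdometer H π) {n : ℕ} (c c' : Γ ⧸ H n) :
    ∃ g : Γ, ∀ x, π n (g • x) = c' ↔ π n x = c := by
  obtain ⟨g, rfl⟩ := MulAction.exists_smul_eq Γ c c'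
  exact ⟨g, fun x => by rw [h.map_smul, smul_left_cancel_iff]⟩

variable [CompactSpace X]

/-- The fibres form a neighbourhood basis, by compactness. -/
theorem exists_fibre_subset (h : IsOdometer H π) {U : Set X} (hU : IsOpen U) {x : X} (hx : x ∈ U) :
    ∃ n, π n ⁻¹' {π n x} ⊆ U := by
  by_contra! hne
  have hc (n) : IsClosed (π n ⁻¹' {π n x} \ U) := (h.isClopen_fibre n _).1.sdiff hU
  obtain ⟨y, hy⟩ := IsCompact.nonempty_iInter_of_sequence_nonempty_isCompact_isClosed
    (fun n => π n ⁻¹' {π n x} \ U) (fun n y hy => ⟨h.eq_of_le n.le_succ hy.1, hy.2⟩)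
    (fun n => Set.sdiff_nonempty.2 (hne n)) (hc 0).isCompact hc
  rw [Set.mem_iInter] at hy
  exact (hy 0).2 (h.separates y x (fun n => (hy n).1) ▸ hx)

/-- A clopen set is a union of fibres of `π n` for all large `n`. -/
theorem exists_eq_preimage (h : IsOdometer H π) {A : Set X} (hA : IsClopen A) :
    ∃ N, ∀ n ≥ N, ∃ D : Set (Γ ⧸ H n), A = π n ⁻¹' D := by
  have (x : X) : ∃ n, π n ⁻¹' {π n x} ⊆ A ∨ π n ⁻¹' {π n x} ⊆ Aᶜ := by
    by_cases hx : x ∈ A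
    · exact (h.exists_fibre_subset hA.2 hx).imp fun n => Or.inl
    · exact (h.exists_fibre_subset hA.1.isOpen_compl hx).imp fun n => Or.inr
  choose n hn using this
  obtain ⟨t, ht⟩ := CompactSpace.elim_nhds_subcover (fun x => π (n x) ⁻¹' {π (n x) x})
    fun x => (h.isClopen_fibre _ _).2.mem_nhds rfl
  refine ⟨t.sup n, fun k hk => ⟨π k '' A, (Set.subset_preimage_image _ _).antisymm ?_⟩⟩
  rintro y ⟨x, hx, hxy⟩
  obtain ⟨z, hz, hxz⟩ := Set.mem_iUnion₂.1 (ht.ge (Set.mem_univ x))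
  have hyz : y ∈ π (n z) ⁻¹' {π (n z) z} :=
    (h.eq_of_le ((Finset.le_sup hz).trans hk) hxy).symm.trans hxz
  rcases hn z with h' | h'
  · exact h' hyz
  · exact absurd hx (h' hxz)

theorem isMinimal (h : IsOdometer H π) : MulAction.IsMinimal Γ X := by
  refine ⟨fun x => dense_iff_inter_open.2 fun U hU ⟨y, hy⟩ => ?_⟩
  obtain ⟨n, hn⟩ := h.exists_fibre_subset hU hy
  obtain ⟨g, hg⟩ := h.exists_map_smul_iff (π n x) (π n y)
  exact ⟨g • x, hn ((hg x).2 rfl), MulAction.mem_orbit x g⟩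

theorem continuousConstSMul (h : IsOdometer H π) : ContinuousConstSMul Γ X := by
  refine ⟨fun g => continuous_iff_continuousAt.2 fun x => ?_⟩
  intro U hU
  obtain ⟨V, hVU, hV, hxV⟩ := mem_nhds_iff.1 hU
  obtain ⟨n, hn⟩ := h.exists_fibre_subset hV hxV
  refine Filter.mem_map.2 (Filter.mem_of_superset
    ((h.isClopen_fibre n (π n x)).2.mem_nhds rfl) fun y hy => hVU (hn ?_))
  change π n (g • y) = π n (g • x)
  rw [h.map_smul, h.map_smul, show π n y = π n x from hy]

end IsOdometer

section Measures

variable {Γ X : Type*} [Group Γ] [MulAction Γ X] [MeasurableSpace X]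

/-- If `Γ` permutes the fibres of `ρ : X → Y` transitively, then they have the same measure. -/
theorem measure_fibre_eq_inv_card {μ : Measure X} (hμ : μ ∈ invariantMeasures Γ X) {Y : Type*}
    [Finite Y] {ρ : X → Y} (hρ : ∀ c, MeasurableSet (ρ ⁻¹' {c}))
    (htrans : ∀ c c', ∃ g : Γ, ∀ x, ρ (g • x) = c' ↔ ρ x = c) (c : Y) :
    μ (ρ ⁻¹' {c}) = (Nat.card Y : ENNReal)⁻¹ := by
  have := hμ.1
  have := hμ.2
  have := Fintype.ofFinite Y
  have heq (c' : Y) : μ (ρ ⁻¹' {c'}) = μ (ρ ⁻¹' {c}) := by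
    obtain ⟨g, hg⟩ := htrans c c'
    rw [← SMulInvariantMeasure.measure_preimage_smul g (hρ c')]
    exact congrArg μ (Set.ext hg)
  have hsum := sum_measure_preimage_singleton (μ := μ) (f := ρ) Finset.univ fun c _ => hρ c
  rw [Finset.sum_congr rfl fun c' _ => heq c', Finset.sum_const, Finset.coe_univ, Set.preimage_univ,
    measure_univ, Finset.card_univ, ← Nat.card_eq_fintype_card, nsmul_eq_mul] at hsum
  exact ENNReal.eq_inv_of_mul_eq_one_left ((mul_comm _ _).trans hsum)

/-- A unique invariant probability measure is ergodic: conditioning it on an invariant set of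
positive measure gives an invariant measure again. -/
theorem ergodicMeasures_eq_of_unique [MeasurableConstSMul Γ X] {μ : Measure X}
    (hμ : invariantMeasures Γ X = {μ}) : ergodicMeasures Γ X = {μ} := by
  have hmem : μ ∈ invariantMeasures Γ X := hμ ▸ rfl
  have := hmem.1
  have := hmem.2
  refine Set.Subset.antisymm (fun ν hν => hμ ▸ ⟨hν.1, hν.2.toSMulInvariantMeasure⟩) ?_
  refine Set.singleton_subset_iff.2 ⟨inferInstance, ⟨fun {s} hs hinv => ?_⟩⟩
  rw [Filter.eventuallyConst_set']
  by_cases h0 : μ s = 0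
  · exact Or.inl (ae_eq_empty.2 h0)
  have hcond : ProbabilityTheory.cond μ s ∈ invariantMeasures Γ X := by
    refine ⟨ProbabilityTheory.cond_isProbabilityMeasure h0, ⟨fun g t ht => ?_⟩⟩
    rw [ProbabilityTheory.cond_apply hs, ProbabilityTheory.cond_apply hs]
    congr 1
    rw [← SMulInvariantMeasure.measure_preimage_smul g (hs.inter ht), Set.preimage_inter]
    exact measure_congr ((hinv g).symm.inter (Filter.EventuallyEq.refl _ _))
  rw [hμ, Set.mem_singleton_iff] at hcond
  refine Or.inr (ae_eq_univ.2 ?_)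
  rw [← hcond, ProbabilityTheory.cond_apply hs]
  simp

variable [TopologicalSpace X] [BorelSpace X] [ContinuousConstSMul Γ X]

open Classical in
/-- In an almost finite action the fixed points of `g ≠ 1` lie on the `g`-boundaries of the towers,
which have arbitrarily small measure. -/
theorem not_isAlmostFinite_of_fixedPoints [T2Space X] {μ : Measure X}
    (hμ : μ ∈ invariantMeasures Γ X) {g : Γ} (hfix : μ {x | g • x = x} ≠ 0) (hg : g ≠ 1) :
    ¬ IsAlmostFinite Γ X := by
  intro haf
  have := hμ.1
  have := hμ.2
  set F : Set X := {x | g • x = x}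
  have hpos : 0 < μ.real F := ENNReal.toReal_pos hfix (measure_ne_top _ _)
  obtain ⟨n, V, S, hV, hdisj, hcard, hcover⟩ :=
    haf {g} (μ.real F / 2) (Finset.singleton_nonempty g) (half_pos hpos)
  have hmeas (i) (s : Γ) : μ.real (s • V i) = μ.real (V i) := by
    rw [measureReal_def, measure_smul, measureReal_def]
  -- The `g`-boundary of the shape `S i`; it is no larger than `{g} * S i \ S i`.
  let T : Fin n → Finset Γ := fun i => (S i).filter fun s => g * s ∉ S i
  have hT (i) : ((T i).card : ℝ) ≤ μ.real F / 2 * (S i).card := by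
    refine le_trans ?_ (hcard i).le
    rw [Nat.cast_le]
    refine Finset.card_le_card_of_injOn (fun s => g * s) (fun s hs => ?_)
      (fun s _ t _ => mul_left_cancel)
    obtain ⟨hs, hs'⟩ := Finset.mem_filter.1 hs
    exact Finset.mem_symmDiff.2 (Or.inl ⟨Finset.mul_mem_mul (Finset.mem_singleton_self g) hs, hs'⟩)
  have hsub : F ⊆ ⋃ p ∈ Finset.univ.sigma T, p.2 • V p.1 := by
    intro x hx
    obtain ⟨i, hi⟩ := Set.mem_iUnion.1 (hcover.ge (Set.mem_univ x))
    obtain ⟨s, hs, hxs⟩ := Set.mem_iUnion₂.1 hi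
    refine Set.mem_iUnion₂.2 ⟨⟨i, s⟩, ?_, hxs⟩
    refine Finset.mem_sigma.2 ⟨Finset.mem_univ _, Finset.mem_filter.2 ⟨hs, fun hgs => ?_⟩⟩
    have hne : (i, g * s) ≠ (i, s) := fun h => hg (mul_eq_right.1 (Prod.ext_iff.1 h).2)
    refine Set.disjoint_left.1 (hdisj i i (g * s) hgs s hs hne) ?_ hxs
    have : g • x ∈ g • s • V i := Set.smul_mem_smul_set hxs
    rwa [show g • x = x from hx, smul_smul] at this
  have hone : ∑ p ∈ Finset.univ.sigma S, μ.real (p.2 • V p.1) ≤ 1 := by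
    rw [← measureReal_biUnion_finset]
    · exact measureReal_le_one
    · rintro ⟨i, s⟩ hs ⟨j, t⟩ ht hne
      refine hdisj i j s (Finset.mem_sigma.1 hs).2 t (Finset.mem_sigma.1 ht).2 fun h => hne ?_
      obtain ⟨rfl, rfl⟩ := Prod.mk.injEq .. ▸ h
      rfl
    · exact fun p _ => ((hV p.1).1.smul p.2).measurableSet
  have : μ.real F ≤ μ.real F / 2 := calc
    μ.real F ≤ ∑ p ∈ Finset.univ.sigma T, μ.real (p.2 • V p.1) :=
      (measureReal_mono hsub (measure_ne_top _ _)).trans (measureReal_biUnion_finset_le _ _)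
    _ = ∑ i, (T i).card * μ.real (V i) := by
      simp [Finset.sum_sigma, hmeas]
    _ ≤ ∑ i, μ.real F / 2 * ((S i).card * μ.real (V i)) := by
      refine Finset.sum_le_sum fun i _ => ?_
      rw [← mul_assoc]
      exact mul_le_mul_of_nonneg_right (hT i) measureReal_nonneg
    _ = μ.real F / 2 * ∑ p ∈ Finset.univ.sigma S, μ.real (p.2 • V p.1) := by
      simp [Finset.sum_sigma, hmeas, Finset.mul_sum]
    _ ≤ μ.real F / 2 := mul_le_of_le_one_right (half_pos hpos).le hone
  linarith

end Measures

namespace IsOdometer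

variable {Γ X : Type*} [Group Γ] [MulAction Γ X] [TopologicalSpace X]
  {H : ℕ → Subgroup Γ} {π : ∀ n, X → Γ ⧸ H n}

section Borel

variable [MeasurableSpace X] [BorelSpace X] [∀ n, (H n).FiniteIndex]

theorem measure_preimage (h : IsOdometer H π) {μ : Measure X} (hμ : μ ∈ invariantMeasures Γ X)
    {n : ℕ} (D : Set (Γ ⧸ H n)) :
    μ (π n ⁻¹' D) = D.ncard * ((Nat.card (Γ ⧸ H n) : ℕ) : ENNReal)⁻¹ := by
  have hm (c) : MeasurableSet (π n ⁻¹' {c}) := (h.isClopen_fibre n c).1.measurableSet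
  have hD := D.toFinite
  have hsum := sum_measure_preimage_singleton (μ := μ) (f := π n) hD.toFinset fun c _ => hm c
  rw [Set.Finite.coe_toFinset] at hsum
  rw [← hsum, Finset.sum_congr rfl fun c _ =>
    measure_fibre_eq_inv_card hμ hm (fun c c' => h.exists_map_smul_iff c c') c,
    Finset.sum_const, nsmul_eq_mul, Set.ncard_eq_toFinset_card D hD]

variable [CompactSpace X]

theorem hasComparison (h : IsOdometer H π) (hne : (invariantMeasures Γ X).Nonempty) :
    HasComparison Γ X := by
  intro A B hA hB _ _ hAB
  obtain ⟨μ, hμ⟩ := hne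
  obtain ⟨N, hN⟩ := h.exists_eq_preimage hA
  obtain ⟨N', hN'⟩ := h.exists_eq_preimage hB
  obtain ⟨n, hn, hn'⟩ : ∃ n, N ≤ n ∧ N' ≤ n := ⟨max N N', le_max_left .., le_max_right ..⟩
  obtain ⟨D, rfl⟩ := hN n hn
  obtain ⟨E, rfl⟩ := hN' n hn'
  have hcard : Nat.card D ≤ Nat.card E := by
    by_contra! hlt
    refine (hAB μ hμ).not_ge ?_
    rw [h.measure_preimage hμ, h.measure_preimage hμ]
    exact mul_le_mul_left (Nat.cast_le.2 hlt.le) _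
  obtain ⟨j⟩ : Nonempty (D ↪ E) := by
    have := Fintype.ofFinite D
    have := Fintype.ofFinite E
    rw [Nat.card_eq_fintype_card, Nat.card_eq_fintype_card] at hcard
    exact Function.Embedding.nonempty_of_card_le hcard
  let e := Finite.equivFin D
  choose γ hγ using fun i : Fin (Nat.card D) =>
    MulAction.exists_smul_eq Γ (e.symm i : Γ ⧸ H n) (j (e.symm i) : Γ ⧸ H n)
  have hsmul (i) : γ i • π n ⁻¹' {(e.symm i : Γ ⧸ H n)} = π n ⁻¹' {(j (e.symm i) : Γ ⧸ H n)} := by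
    ext x
    rw [Set.mem_smul_set_iff_inv_smul_mem, Set.mem_preimage, Set.mem_preimage, h.map_smul,
      Set.mem_singleton_iff, Set.mem_singleton_iff, inv_smul_eq_iff, hγ]
  refine ⟨Nat.card D, fun i => π n ⁻¹' {(e.symm i : Γ ⧸ H n)}, γ,
    fun i => h.isClopen_fibre n _, fun i i' hne => ?_, ?_, fun i i' hne => ?_, fun i => ?_⟩
  · refine Disjoint.preimage _ (Set.disjoint_singleton.2 fun heq => hne ?_)
    exact e.symm.injective (Subtype.ext heq)
  · rw [← Set.preimage_iUnion]
    congr 1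
    ext c
    rw [Set.mem_iUnion]
    refine ⟨?_, fun hc => ⟨e ⟨c, hc⟩, by rw [e.symm_apply_apply]; rfl⟩⟩
    rintro ⟨i, rfl⟩
    exact (e.symm i).2
  · dsimp only
    rw [hsmul, hsmul]
    refine Disjoint.preimage _ (Set.disjoint_singleton.2 fun heq => hne ?_)
    exact e.symm.injective (j.injective (Subtype.ext heq))
  · rw [hsmul]
    exact Set.preimage_mono (Set.singleton_subset_iff.2 (j (e.symm i)).2)

variable [T2Space X] [SecondCountableTopology X] [TotallyDisconnectedSpace X]

/-- Two finite measures that agree on the fibres of all the maps `π n` are equal. -/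
theorem measure_ext (h : IsOdometer H π) {μ ν : Measure X} [IsFiniteMeasure μ]
    (huniv : μ Set.univ = ν Set.univ) (heq : ∀ n c, μ (π n ⁻¹' {c}) = ν (π n ⁻¹' {c})) : μ = ν := by
  have hbasis : TopologicalSpace.IsTopologicalBasis {s : Set X | IsClopen s} :=
    isTopologicalBasis_isClopen
  refine ext_of_generate_finite {s : Set X | IsClopen s}
    ((BorelSpace.measurable_eq).trans hbasis.borel_eq_generateFrom)
    (fun s hs t ht _ => IsClopen.inter hs ht) (fun A hA => ?_) huniv
  obtain ⟨n, hn⟩ := h.exists_eq_preimage hA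
  obtain ⟨D, rfl⟩ := hn n le_rfl
  have hm (c) : MeasurableSet (π n ⁻¹' {c}) := (h.isClopen_fibre n c).1.measurableSet
  have hsum (ρ : Measure X) :=
    sum_measure_preimage_singleton (μ := ρ) (f := π n) D.toFinite.toFinset fun c _ => hm c
  simp only [Set.Finite.coe_toFinset] at hsum
  rw [← hsum μ, ← hsum ν, Finset.sum_congr rfl fun c _ => heq n c]

theorem invariantMeasures_subsingleton (h : IsOdometer H π) :
    (invariantMeasures Γ X).Subsingleton := by
  intro μ hμ ν hν
  have := hμ.1
  have := hν.1
  refine h.measure_ext (by simp) fun n c => ?_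
  rw [h.measure_preimage hμ, h.measure_preimage hν]

theorem mem_invariantMeasures (h : IsOdometer H π) {μ : Measure X} [IsProbabilityMeasure μ]
    (heq : ∀ n c c', μ (π n ⁻¹' {c}) = μ (π n ⁻¹' {c'})) : μ ∈ invariantMeasures Γ X := by
  have := h.continuousConstSMul
  refine ⟨inferInstance, ((smulInvariantMeasure_tfae Γ μ).out 0 5).2 fun g => ?_⟩
  have hg : Measurable fun x : X => g • x := measurable_const_smul g
  have := Measure.isProbabilityMeasure_map (μ := μ) hg.aemeasurable
  refine h.measure_ext (measure_univ.trans measure_univ.symm) fun n c => ?_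
  rw [Measure.map_apply hg (h.isClopen_fibre n c).1.measurableSet, ← heq n (g⁻¹ • c) c]
  congr 1
  ext x
  simp [h.map_smul, eq_inv_smul_iff]

end Borel

/-- If the subgroups have trivial intersection, then the orbit of the base point consists of points
with trivial stabilizer; as it is dense, no `g ≠ 1` fixes a nonempty open set. -/
theorem isTopologicallyFree [Countable Γ] [CompactSpace X] [T2Space X] (h : IsOdometer H π)
    (hbot : ∀ g, (∀ n, g ∈ H n) → g = 1) {x₀ : X} (hx₀ : ∀ n, π n x₀ = (1 : Γ)) :
    IsTopologicallyFree Γ X := by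
  have := h.continuousConstSMul
  have := h.isMinimal
  have hstab (g : Γ) (hg : g • x₀ = x₀) : g = 1 := by
    refine hbot g fun n => ?_
    have := h.map_smul n g x₀
    rw [hg, hx₀, MulAction.Quotient.smul_coe, smul_eq_mul, mul_one, QuotientGroup.eq] at this
    simpa using this
  have hset : {x : X | MulAction.stabilizer Γ x = ⊥} =
      ⋂ g : {g : Γ // g ≠ 1}, {x | g.1 • x ≠ x} := by
    ext x
    simp only [Set.mem_ofPred_eq, Set.mem_iInter, Subtype.forall, Subgroup.eq_bot_iff_forall,
      MulAction.mem_stabilizer_iff]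
    exact forall_congr' fun g => not_imp_not.symm
  rw [IsTopologicallyFree, hset, countable_iInter_mem]
  rintro ⟨g, hg⟩
  have hopen : IsOpen {x : X | g • x ≠ x} := isOpen_ne_fun (continuous_const_smul g) continuous_id
  refine residual_of_dense_open hopen ?_
  refine (MulAction.dense_orbit Γ x₀).mono ?_
  rintro _ ⟨a, rfl⟩ hfix
  refine hg ?_
  have : (a⁻¹ * g * a) • x₀ = x₀ := by
    rw [mul_smul, mul_smul, inv_smul_eq_iff]
    exact hfix
  simpa [mul_assoc, inv_mul_eq_one] using hstab _ this

end IsOdometer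

/-- The odometer of a strictly decreasing chain of finite-index subgroups, realized on the space of
binary sequences. -/
theorem exists_odometer {Γ : Type*} [Group Γ] {H : ℕ → Subgroup Γ} (hH : StrictAnti H)
    (h0 : H 0 = ⊤) [∀ n, (H n).FiniteIndex] :
    ∃ (_ : MulAction Γ (ℕ → Bool)) (π : ∀ n, (ℕ → Bool) → Γ ⧸ H n), IsOdometer H π ∧
      (∃ x₀, ∀ n, π n x₀ = (1 : Γ)) ∧ (invariantMeasures Γ (ℕ → Bool)).Nonempty := by
  have hle (n) : H (n + 1) ≤ H n := (hH n.lt_succ_self).le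
  have hequiv (n) : ∃ k, Nonempty (H n ⧸ (H (n + 1)).subgroupOf (H n) ≃ Fin (k + 2)) := by
    have hne : ((H (n + 1)).subgroupOf (H n)).index ≠ 1 := fun h =>
      (hH n.lt_succ_self).not_ge (Subgroup.relIndex_eq_one.1 h)
    have hne0 : ((H (n + 1)).subgroupOf (H n)).index ≠ 0 := Subgroup.FiniteIndex.index_ne_zero
    have : Finite (H n ⧸ (H (n + 1)).subgroupOf (H n)) := Subgroup.finite_quotient_of_finiteIndex
    refine ⟨((H (n + 1)).subgroupOf (H n)).index - 2, ⟨Finite.equivFinOfCardEq ?_⟩⟩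
    change ((H (n + 1)).subgroupOf (H n)).index = _
    omega
  choose k e using hequiv
  let φ (n) : Γ ⧸ H (n + 1) ≃ (Γ ⧸ H n) × Fin (k n + 2) :=
    (Subgroup.quotientEquivProdOfLE (hle n)).trans (Equiv.prodCongr (Equiv.refl _) (e n).some)
  have hφ (n) (a : Γ) : (φ n (a : Γ ⧸ H (n + 1))).1 = a := rfl
  have hφs (n) (g : Γ) (c) : (φ n (g • c)).1 = g • (φ n c).1 := by
    induction c using QuotientGroup.induction_on
    rfl
  have : Subsingleton (Γ ⧸ H 0) := by rw [h0]; exact QuotientGroup.subsingleton_quotient_top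
  obtain ⟨π, hclopen, hcompat, hsep, hcomplete, μ, hμ, hμeq⟩ :=
    exists_cantor_tower (fun n => Γ ⧸ H n) k φ
  have hact (g : Γ) (x : ℕ → Bool) : ∃ y, ∀ n, π n y = g • π n x :=
    hcomplete _ fun n => by rw [hφs, hcompat]
  choose act hact using hact
  let _ : MulAction Γ (ℕ → Bool) :=
    { toSMul := ⟨act⟩
      one_smul := fun x => hsep _ _ fun n => (hact 1 x n).trans (one_smul Γ _)
      mul_smul := fun g g' x => hsep _ _ fun n => by
        change π n (act (g * g') x) = π n (act g (act g' x))
        rw [hact, hact, hact, mul_smul] }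
  have hodo : IsOdometer H π :=
    { isClopen_fibre := hclopen
      map_smul := fun n g x => hact g x n
      map_mk := fun {m n x γ} hmn => by
        induction n, hmn using Nat.le_induction with
        | base => exact id
        | succ n _ ih =>
          intro h
          exact ih (by rw [← hcompat, h, hφ])
      separates := hsep }
  exact ⟨inferInstance, π, hodo, hcomplete (fun n => (1 : Γ)) fun n => hφ n 1, μ,
    hodo.mem_invariantMeasures hμeq⟩

end Odometer

/-! ### Finite-index subgroups of wreath products -/

section Wreath

open MeasureTheory Filter

section Subgroups

variable {A Λ : Type*} [AddCommGroup A] [Group Λ]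

/-- The sums of a finitely supported function over the left cosets of a subgroup. -/
noncomputable def cosetSum (N : Subgroup Λ) : (Λ →₀ A) →+ (Λ ⧸ N →₀ A) :=
  Finsupp.mapDomain.addMonoidHom fun x : Λ => (x : Λ ⧸ N)

theorem cosetSum_shiftHom (N : Subgroup Λ) (γ : Λ) (f : Multiplicative (Λ →₀ A)) (c : Λ ⧸ N) :
    cosetSum N (shiftHom A Λ γ f).toAdd c = cosetSum N f.toAdd (γ⁻¹ • c) := by
  have h1 : (shiftHom A Λ γ f).toAdd = Finsupp.mapDomain (Equiv.mulLeft γ) f.toAdd :=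
    Finsupp.equivMapDomain_eq_mapDomain _ _
  have h2 : (fun x : Λ => (x : Λ ⧸ N)) ∘ Equiv.mulLeft γ =
      (MulAction.toPerm γ : Equiv.Perm (Λ ⧸ N)) ∘ fun x : Λ => (x : Λ ⧸ N) := rfl
  rw [h1]
  change Finsupp.mapDomain _ (Finsupp.mapDomain _ _) c = _
  rw [← Finsupp.mapDomain_comp, h2, Finsupp.mapDomain_comp, Finsupp.mapDomain_equiv_apply]
  rfl

theorem smul_mk_of_mem {N : Subgroup Λ} [N.Normal] {γ : Λ} (hγ : γ ∈ N) (c : Λ ⧸ N) :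
    γ • c = c := by
  induction c using QuotientGroup.induction_on with | H x =>
  rw [MulAction.Quotient.smul_coe, smul_eq_mul, QuotientGroup.mk_mul,
    (QuotientGroup.eq_one_iff γ).2 hγ, one_mul]

/-- The elements `(f, γ)` of `A ≀ Λ` for which `γ` lies in the normal subgroup `N`, and the sums
of `f` over the cosets of `N` represented in `E` lie in `B`. -/
noncomputable def wreathSubgroup (N : Subgroup Λ) [N.Normal] (E : Set Λ) (B : AddSubgroup A) :
    Subgroup (WreathProduct A Λ) where
  carrier := {g | g.right ∈ N ∧ ∀ x ∈ E, cosetSum N g.left.toAdd (x : Λ ⧸ N) ∈ B}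
  one_mem' := ⟨N.one_mem, fun x _ => by simp⟩
  mul_mem' := by
    rintro g h ⟨hg, hg'⟩ ⟨hh, hh'⟩
    refine ⟨N.mul_mem hg hh, fun x hx => ?_⟩
    rw [SemidirectProduct.mul_left, toAdd_mul, map_add, Finsupp.add_apply, cosetSum_shiftHom,
      smul_mk_of_mem (N.inv_mem hg)]
    exact B.add_mem (hg' x hx) (hh' x hx)
  inv_mem' := by
    rintro g ⟨hg, hg'⟩
    refine ⟨N.inv_mem hg, fun x hx => ?_⟩
    rw [SemidirectProduct.inv_left, cosetSum_shiftHom, inv_inv, smul_mk_of_mem hg, toAdd_inv,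
      map_neg, Finsupp.neg_apply]
    exact B.neg_mem (hg' x hx)

theorem finiteIndex_of_map {G T : Type*} [Group G] [Finite T] {K : Subgroup G} (F : G → T)
    (hF : ∀ a b, F a = F b → a⁻¹ * b ∈ K) : K.FiniteIndex := by
  have : Finite (G ⧸ K) := Finite.of_injective (fun c : G ⧸ K => F c.out) fun c c' h => by
    rw [← c.out_eq', ← c'.out_eq']
    exact QuotientGroup.eq.2 (hF _ _ h)
  exact Subgroup.finiteIndex_of_finite_quotient

theorem finiteIndex_wreathSubgroup (N : Subgroup Λ) [N.Normal] [N.FiniteIndex] (E : Set Λ)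
    (B : AddSubgroup A) [B.FiniteIndex] : (wreathSubgroup N E B).FiniteIndex := by
  refine finiteIndex_of_map (T := (Λ ⧸ N) × (Λ ⧸ N → A ⧸ B))
    (fun g => (g.right, fun c => (cosetSum N g.left.toAdd c : A ⧸ B))) fun a b hab => ?_
  obtain ⟨h1, h2⟩ := Prod.ext_iff.1 hab
  refine ⟨QuotientGroup.eq.1 h1, fun x _ => ?_⟩
  rw [SemidirectProduct.mul_left, SemidirectProduct.inv_left, SemidirectProduct.inv_right,
    toAdd_mul, map_add, Finsupp.add_apply, cosetSum_shiftHom, cosetSum_shiftHom, toAdd_inv, map_neg,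
    Finsupp.neg_apply]
  exact QuotientAddGroup.eq.1 (congrFun h2 _)

theorem conj_inl (f : Multiplicative (Λ →₀ A)) (γ : WreathProduct A Λ) :
    γ⁻¹ * SemidirectProduct.inl f * γ =
      SemidirectProduct.inl (shiftHom A Λ γ.right⁻¹ f) := by
  refine SemidirectProduct.ext ?_ (by simp)
  simp [mul_comm, mul_left_comm]

/-- A conjugate of an element supported at a single point stays in `wreathSubgroup N E B` unless the
conjugation moves this point into one of the cosets over which sums are controlled. -/
theorem exists_mk_eq_of_conj_notMem {N : Subgroup Λ} [N.Normal] {E : Set Λ} {B : AddSubgroup A}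
    {v : A} {γ : WreathProduct A Λ}
    (h : γ⁻¹ * SemidirectProduct.inl (Multiplicative.ofAdd (Finsupp.single 1 v)) * γ ∉
      wreathSubgroup N E B) :
    ∃ x ∈ E, (γ.right : Λ ⧸ N) = (x⁻¹ : Λ) := by
  classical
  by_contra! hne
  refine h ?_
  rw [conj_inl]
  refine ⟨N.one_mem, fun x hx => ?_⟩
  rw [SemidirectProduct.left_inl, cosetSum_shiftHom, inv_inv]
  have : cosetSum N (Finsupp.single 1 v) = Finsupp.single ((1 : Λ) : Λ ⧸ N) v :=
    Finsupp.mapDomain_single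
  rw [toAdd_ofAdd, this, Finsupp.single_apply, if_neg]
  · exact B.zero_mem
  · intro heq
    refine hne x hx ?_
    rw [MulAction.Quotient.smul_coe, smul_eq_mul, QuotientGroup.mk_mul, QuotientGroup.mk_one] at heq
    rw [QuotientGroup.mk_inv]
    exact eq_inv_of_mul_eq_one_left heq.symm

theorem eq_one_of_forall_mem_wreathSubgroup {N : ℕ → Subgroup Λ} [∀ m, (N m).Normal]
    {E : ℕ → Set Λ} {B : ℕ → AddSubgroup A}
    (hN : ∀ S : Finset Λ, ∀ᶠ m in atTop, Set.InjOn (fun x : Λ => (x : Λ ⧸ N m)) S)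
    (hE : ∀ x, ∀ᶠ m in atTop, x ∈ E m) (hB : ∀ a, a ≠ 0 → ∀ᶠ m in atTop, a ∉ B m)
    {g : WreathProduct A Λ} (hg : ∀ m, g ∈ wreathSubgroup (N m) (E m) (B m)) : g = 1 := by
  classical
  refine SemidirectProduct.ext ?_ ?_
  · refine Multiplicative.toAdd.injective (Finsupp.ext fun x => ?_)
    by_contra hx
    obtain ⟨m, hm1, hm2, hm3⟩ :=
      ((hN (insert x g.left.toAdd.support)).and ((hE x).and (hB _ hx))).exists
    refine hm3 ?_
    have h := (hg m).2 x hm2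
    have heq : cosetSum (N m) g.left.toAdd (x : Λ ⧸ N m) = g.left.toAdd x :=
      Finsupp.mapDomain_apply' _ _ (by simp) hm1 (by simp)
    rwa [heq] at h
  · obtain ⟨m, hm⟩ := (hN {1, g.right}).exists
    refine hm (by simp) (by simp) ?_
    exact (QuotientGroup.eq_one_iff _).2 (hg m).1

end Subgroups

/-- A residually finite group maps to a finite quotient injectively on any given finite set. -/
theorem exists_normal_injOn {Λ : Type*} [Group Λ] [Group.ResiduallyFinite Λ] (F : Finset Λ) :
    ∃ N : Subgroup Λ, N.Normal ∧ N.FiniteIndex ∧ Set.InjOn (fun x : Λ => (x : Λ ⧸ N)) F := by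
  have (p : Λ × Λ) : ∃ N : FiniteIndexNormalSubgroup Λ, p.1 ≠ p.2 → p.1⁻¹ * p.2 ∉ N := by
    by_cases hp : p.1 = p.2
    · exact ⟨.ofSubgroup ⊤, fun h => absurd hp h⟩
    · obtain ⟨N, hN⟩ := Group.exists_finiteIndexNormalSubgroup_notMem (p.1⁻¹ * p.2)
        (fun h => hp (inv_mul_eq_one.1 h))
      exact ⟨N, fun _ => hN⟩
  choose N hN using this
  refine ⟨⨅ p : (F ×ˢ F : Finset (Λ × Λ)), (N p.1).toSubgroup,
    Subgroup.normal_iInf_normal fun p => inferInstance,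
    Subgroup.finiteIndex_iInf fun p => inferInstance, fun a ha b hb hab => ?_⟩
  by_contra hne
  exact hN (a, b) hne ((Subgroup.mem_iInf.1 (QuotientGroup.eq.1 hab))
    ⟨(a, b), Finset.mem_product.2 ⟨ha, hb⟩⟩)

/-- Finite-index subgroups of an infinite group with trivial intersection can be intersected to a
strictly decreasing chain. -/
theorem exists_strictAnti_chain {Γ : Type*} [Group Γ] [Infinite Γ] (G : ℕ → Subgroup Γ)
    [hG : ∀ m, (G m).FiniteIndex] (hbot : ∀ g, (∀ m, g ∈ G m) → g = 1) :
    ∃ H : ℕ → Subgroup Γ, StrictAnti H ∧ H 0 = ⊤ ∧ (∀ n, (H n).FiniteIndex) ∧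
      (∀ m, ∃ n, H n ≤ G m) ∧ ∀ n, ∃ M, ∀ g, (∀ m < M, g ∈ G m) → g ∈ H n := by
  let K : ℕ → Subgroup Γ := fun n => Nat.rec ⊤ (fun n L => L ⊓ G n) n
  have hK (n) : (K n).FiniteIndex := by
    induction n with
    | zero => exact inferInstanceAs (⊤ : Subgroup Γ).FiniteIndex
    | succ n ih =>
      exact ⟨Subgroup.index_inf_ne_zero ih.index_ne_zero (hG n).index_ne_zero⟩
  have hKanti : Antitone K := antitone_nat_of_succ_le fun n => inf_le_left
  have hmem (n) (g) : g ∈ K n ↔ ∀ m < n, g ∈ G m := by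
    induction n with
    | zero => simp [K]
    | succ n ih =>
      rw [Nat.forall_lt_succ_right, ← ih]
      exact Subgroup.mem_inf
  have hlt (n) : ∃ n', n < n' ∧ K n' < K n := by
    refine not_forall_not.1 fun h => ?_
    have h' (n') (hn : n < n') : ¬ K n' < K n := fun hlt => h n' ⟨hn, hlt⟩
    have hle (m) : K n ≤ K m := by
      rcases le_or_gt m n with hmn | hmn
      · exact hKanti hmn
      · exact (lt_or_eq_of_le (hKanti hmn.le)).elim (fun hlt => absurd hlt (h' m hmn)) Eq.ge
    have htriv : K n = ⊥ := (Subgroup.eq_bot_iff_forall _).2 fun g hg =>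
      hbot g fun m => (hmem (m + 1) g).1 (hle (m + 1) hg) m m.lt_succ_self
    have := hK n
    rw [htriv] at this
    have : Finite (Γ ⧸ (⊥ : Subgroup Γ)) := Subgroup.finite_quotient_of_finiteIndex
    have : Finite Γ := Finite.of_equiv _ (QuotientGroup.quotientBot (G := Γ)).toEquiv
    exact not_finite Γ
  choose f hf hf' using hlt
  let φ : ℕ → ℕ := fun n => f^[n] 0
  have hφ (n) : φ (n + 1) = f (φ n) := Function.iterate_succ_apply' f n 0
  have hφmono : StrictMono φ := strictMono_nat_of_lt_succ fun n => hφ n ▸ hf _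
  refine ⟨fun n => K (φ n), strictAnti_nat_of_succ_lt fun n => ?_, rfl, fun n => hK _,
    fun m => ⟨m + 1, fun g hg => (hmem _ g).1 hg m (hφmono.le_apply.trans_lt' m.lt_succ_self)⟩,
    fun n => ⟨φ n, fun g => (hmem _ g).2⟩⟩
  rw [hφ]
  exact hf' _

theorem tsum_half_pow_lt_one : ∑' m : ℕ, (2⁻¹ : ENNReal) ^ (m + 2) < 1 := by
  simp_rw [pow_succ _ (_ + 1), ENNReal.tsum_mul_right, ENNReal.tsum_geometric_add_one,
    ENNReal.one_sub_inv_two, inv_inv]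
  rw [ENNReal.inv_mul_cancel two_ne_zero ENNReal.ofNat_ne_top, one_mul]
  exact ENNReal.inv_lt_one.2 ENNReal.one_lt_two

/-- In the odometer of the chain `H`, an element supported at a single point fixes a set of positive
measure: it can move `x` only if, for some `m`, the coset in `Λ ⧸ N m` determined by `x` lies in a
set of at most `(E m).card` cosets, and all cosets carry the same measure. -/
theorem measure_fixedPoints_ne_zero {A Λ X : Type*} [AddCommGroup A] [Group Λ] [TopologicalSpace X]
    [MeasurableSpace X] [BorelSpace X] [MulAction (WreathProduct A Λ) X]
    {N : ℕ → Subgroup Λ} [∀ m, (N m).Normal] [∀ m, (N m).FiniteIndex] {E : ℕ → Finset Λ}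
    {B : ℕ → AddSubgroup A} {H : ℕ → Subgroup (WreathProduct A Λ)} [∀ n, (H n).FiniteIndex]
    {π : ∀ n, X → WreathProduct A Λ ⧸ H n} (h : IsOdometer H π)
    (hle : ∀ m, ∃ n, H n ≤ wreathSubgroup (N m) (E m) (B m))
    (hmem : ∀ n, ∃ M, ∀ g, (∀ m < M, g ∈ wreathSubgroup (N m) (E m) (B m)) → g ∈ H n)
    (hcard : ∀ m, (E m).card * 2 ^ (m + 2) ≤ (N m).index) (v : A)
    {μ : Measure X} (hμ : μ ∈ invariantMeasures (WreathProduct A Λ) X) :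
    μ {x | (SemidirectProduct.inl (Multiplicative.ofAdd (Finsupp.single 1 v)) :
      WreathProduct A Λ) • x = x} ≠ 0 := by
  classical
  set g : WreathProduct A Λ := SemidirectProduct.inl (Multiplicative.ofAdd (Finsupp.single 1 v))
  have := hμ.1
  choose n hn using hle
  -- The level of the odometer that determines cosets of `N m`, followed by the projection to `Λ`.
  let q (m : ℕ) : WreathProduct A Λ ⧸ H (n m) → Λ ⧸ N m :=
    Quotient.map' SemidirectProduct.right fun a b hab => by
      rw [QuotientGroup.leftRel_apply] at hab ⊢
      exact (hn m hab).1
  let ρ (m : ℕ) (x : X) : Λ ⧸ N m := q m (π (n m) x)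
  have hq (m) (γ : WreathProduct A Λ) (c) : q m (γ • c) = γ.right • q m c := by
    induction c using QuotientGroup.induction_on
    rfl
  have hmeas (m) (c) : MeasurableSet (ρ m ⁻¹' {c}) := by
    have : ρ m ⁻¹' {c} = ⋃ c' ∈ q m ⁻¹' {c}, π (n m) ⁻¹' {c'} := by
      ext x
      simp [ρ]
    rw [this]
    exact MeasurableSet.biUnion (Set.to_countable _) fun c' _ =>
      (h.isClopen_fibre _ c').1.measurableSet
  have hρ (m) (c) : μ (ρ m ⁻¹' {c}) = ((N m).index : ENNReal)⁻¹ := by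
    refine measure_fibre_eq_inv_card hμ (hmeas m) (fun c c' => ?_) c
    obtain ⟨γ, rfl⟩ := MulAction.exists_smul_eq Λ c c'
    refine ⟨SemidirectProduct.inr γ, fun x => ?_⟩
    change q m (π (n m) _) = _ ↔ _
    rw [h.map_smul, hq, SemidirectProduct.right_inr, smul_left_cancel_iff]
  let D (m : ℕ) : Set X := ⋃ y ∈ E m, ρ m ⁻¹' {((y⁻¹ : Λ) : Λ ⧸ N m)}
  have hD (m) : μ (D m) ≤ 2⁻¹ ^ (m + 2) := by
    refine (measure_biUnion_finset_le _ _).trans ?_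
    rw [Finset.sum_congr rfl fun y _ => hρ m _, Finset.sum_const, nsmul_eq_mul,
      ← div_eq_mul_inv, ← ENNReal.inv_pow]
    have hidx : ((N m).index : ENNReal) ≠ 0 := Nat.cast_ne_zero.2 Subgroup.FiniteIndex.index_ne_zero
    refine ENNReal.div_le_of_le_mul ?_
    rw [mul_comm, ← div_eq_mul_inv,
      ENNReal.le_div_iff_mul_le (Or.inl (by simp)) (Or.inl (by simp))]
    exact_mod_cast hcard m
  have hsub : {x | g • x = x}ᶜ ⊆ ⋃ m, D m := by
    intro x hx
    obtain ⟨k, hk⟩ : ∃ k, π k (g • x) ≠ π k x := by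
      by_contra! hall
      exact hx (h.separates _ _ hall)
    obtain ⟨M, hM⟩ := hmem k
    -- A level that is beyond `k` and determines the cosets of `N m` for all relevant `m`.
    let l := max k ((Finset.range M).sup n)
    obtain ⟨γ, hγ⟩ := QuotientGroup.mk_surjective (π l x)
    obtain ⟨m, hmM, hm⟩ : ∃ m < M, γ⁻¹ * g * γ ∉ wreathSubgroup (N m) (E m) (B m) := by
      by_contra! hall
      refine hk ?_
      rw [h.map_smul, h.map_mk (le_max_left ..) hγ.symm, MulAction.Quotient.smul_coe, smul_eq_mul,
        eq_comm, QuotientGroup.eq, ← mul_assoc]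
      exact hM _ hall
    obtain ⟨y, hy, hγy⟩ := exists_mk_eq_of_conj_notMem hm
    refine Set.mem_iUnion.2 ⟨m, Set.mem_iUnion₂.2 ⟨y, hy, ?_⟩⟩
    have hml : n m ≤ l := (Finset.le_sup (Finset.mem_range.2 hmM)).trans (le_max_right ..)
    change q m (π (n m) x) = _
    rw [h.map_mk hml hγ.symm]
    exact hγy
  intro h0
  have h1 : (1 : ENNReal) ≤ ∑' m : ℕ, (2⁻¹ : ENNReal) ^ (m + 2) := calc
    1 = μ Set.univ := measure_univ.symm
    _ = μ ({x | g • x = x} ∪ {x | g • x = x}ᶜ) := by rw [Set.union_compl_self]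
    _ ≤ μ {x | g • x = x} + μ {x | g • x = x}ᶜ := measure_union_le _ _
    _ ≤ 0 + μ (⋃ m, D m) := add_le_add h0.le (measure_mono hsub)
    _ ≤ ∑' m, μ (D m) := by rw [zero_add]; exact measure_iUnion_le _
    _ ≤ _ := ENNReal.tsum_le_tsum hD
  exact h1.not_gt tsum_half_pow_lt_one

end Wreath

/-! ### Amenability -/

section Amenable

/-- Amenability bounds the boundaries `{s ∈ S | k * s ∉ S}` separately for each `k ∈ K`. -/
theorem IsAmenable.exists_card_boundary_le {G : Type*} [Group G] [DecidableEq G]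
    (hG : IsAmenable G) (K : Finset G) {ε : ℝ} (hε : 0 < ε) :
    ∃ S : Finset G, S.Nonempty ∧
      ∀ k ∈ K, ((S.filter fun s => k * s ∉ S).card : ℝ) ≤ ε * S.card := by
  obtain rfl | hK := K.eq_empty_or_nonempty
  · exact ⟨{1}, Finset.singleton_nonempty 1, by simp⟩
  obtain ⟨S, hS, hcard⟩ := hG K ε hK hε
  refine ⟨S, hS, fun k hk => le_trans (Nat.cast_le.2 ?_) hcard.le⟩
  refine Finset.card_le_card_of_injOn (fun s => k * s) (fun s hs => ?_)
    fun s _ t _ => mul_left_cancel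
  obtain ⟨hs, hs'⟩ := Finset.mem_filter.1 hs
  exact (@Finset.mem_symmDiff ..).2 (Or.inl ⟨(@Finset.mem_mul ..).2 ⟨k, hk, s, hs, rfl⟩, hs'⟩)

open Classical in
theorem isAmenable_of_exists_card_boundary_le {G : Type*} [Group G]
    (h : ∀ (K : Finset G) (ε : ℝ), 0 < ε → ∃ S : Finset G, S.Nonempty ∧
      ∀ k ∈ K, ((S.filter fun s => k * s ∉ S).card : ℝ) ≤ ε * S.card) : IsAmenable G := by
  intro K ε hK hε
  obtain ⟨k₀, hk₀⟩ := hK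
  have hc : (0 : ℝ) < K.card + 1 := by positivity
  obtain ⟨S, hS, hb⟩ := h K (ε / 2 / (K.card + 1)) (by positivity)
  refine ⟨S, hS, ?_⟩
  set b : G → Finset G := fun k => S.filter fun s => k * s ∉ S
  have h1 : (K * S) \ S ⊆ K.biUnion fun k => (b k).image fun s => k * s := by
    intro x hx
    obtain ⟨hx, hxS⟩ := Finset.mem_sdiff.1 hx
    obtain ⟨k, hk, s, hs, rfl⟩ := Finset.mem_mul.1 hx
    exact Finset.mem_biUnion.2 ⟨k, hk, Finset.mem_image.2 ⟨s, Finset.mem_filter.2 ⟨hs, hxS⟩, rfl⟩⟩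
  -- `S \ k₀S` has as many elements as `k₀S \ S`, because `k₀S` and `S` are equinumerous.
  have h2 : (S \ (K * S)).card ≤ (b k₀).card := by
    have hle : (S \ (K * S)).card ≤ (S \ S.image fun s => k₀ * s).card := by
      refine Finset.card_le_card (Finset.sdiff_subset_sdiff Finset.Subset.rfl ?_)
      intro x hx
      obtain ⟨s, hs, rfl⟩ := Finset.mem_image.1 hx
      exact Finset.mul_mem_mul hk₀ hs
    have hcard : (S.image fun s => k₀ * s).card = S.card :=
      Finset.card_image_of_injective _ (mul_right_injective k₀)
    rw [Finset.card_sdiff_comm hcard.symm] at hle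
    refine hle.trans ((Finset.card_le_card ?_).trans
      (Finset.card_image_le (s := b k₀) (f := fun s => k₀ * s)))
    intro x hx
    obtain ⟨hx, hxS⟩ := Finset.mem_sdiff.1 hx
    obtain ⟨s, hs, rfl⟩ := Finset.mem_image.1 hx
    exact Finset.mem_image.2 ⟨s, Finset.mem_filter.2 ⟨hs, hxS⟩, rfl⟩
  have hSpos : (0 : ℝ) < S.card := Nat.cast_pos.2 hS.card_pos
  calc ((symmDiff (K * S) S).card : ℝ)
      ≤ ((K * S) \ S).card + (S \ (K * S)).card := by
        exact_mod_cast Finset.card_union_le _ _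
    _ ≤ (∑ k ∈ K, ((b k).card : ℝ)) + (b k₀).card := by
        refine add_le_add ?_ (Nat.cast_le.2 h2)
        refine (Nat.cast_le.2 ((Finset.card_le_card h1).trans Finset.card_biUnion_le)).trans ?_
        rw [Nat.cast_sum]
        exact Finset.sum_le_sum fun k _ => Nat.cast_le.2 Finset.card_image_le
    _ ≤ (∑ k ∈ K, ε / 2 / (K.card + 1) * S.card) + ε / 2 / (K.card + 1) * S.card :=
        add_le_add (Finset.sum_le_sum fun k hk => hb k hk) (hb k₀ hk₀)
    _ = ε / 2 * S.card := by
        rw [Finset.sum_const, nsmul_eq_mul]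
        field_simp
    _ < ε * S.card := by nlinarith

theorem card_pow_le_of_comm {G : Type*} [CommGroup G] [DecidableEq G] (K : Finset G) (n : ℕ) :
    (K ^ n).card ≤ (n + 1) ^ K.card := by
  have key : ∀ g ∈ K ^ n, ∃ a : G → ℕ, (∀ k, a k ≤ n) ∧ ∏ k ∈ K, k ^ a k = g := by
    induction n with
    | zero => exact fun g hg => ⟨0, by simp, by simpa [eq_comm] using hg⟩
    | succ n ih =>
      intro g hg
      rw [pow_succ] at hg
      obtain ⟨g, hg', k₀, hk₀, rfl⟩ := Finset.mem_mul.1 hg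
      obtain ⟨a, ha, rfl⟩ := ih g hg'
      refine ⟨fun k => a k + if k = k₀ then 1 else 0, fun k => ?_, ?_⟩
      · have := ha k
        dsimp only
        split_ifs <;> omega
      · simp_rw [pow_add, Finset.prod_mul_distrib, pow_ite, pow_one, pow_zero]
        rw [Finset.prod_ite_eq' K k₀, if_pos hk₀]
  calc (K ^ n).card
      ≤ ((Finset.univ : Finset (K → Fin (n + 1))).image
          fun a => ∏ k : K, (k : G) ^ (a k : ℕ)).card := by
        refine Finset.card_le_card fun g hg => ?_
        obtain ⟨a, ha, rfl⟩ := key g hg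
        refine Finset.mem_image.2 ⟨fun k => ⟨a k, Nat.lt_succ_of_le (ha k)⟩, Finset.mem_univ _, ?_⟩
        exact Finset.prod_coe_sort K fun k => k ^ a k
    _ ≤ (Finset.univ : Finset (K → Fin (n + 1))).card := Finset.card_image_le
    _ = (n + 1) ^ K.card := by simp

/-- Abelian groups are amenable: the powers of a finite set grow polynomially, so that some power
is almost invariant. -/
theorem isAmenable_of_comm {G : Type*} [Group G] (hcomm : ∀ a b : G, a * b = b * a) :
    IsAmenable G := by
  classical
  let _ : CommGroup G := { ‹Group G› with mul_comm := hcomm }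
  refine isAmenable_of_exists_card_boundary_le fun K ε hε => ?_
  by_contra! hne
  set L : Finset G := insert 1 K
  have hL1 : (1 : G) ∈ L := Finset.mem_insert_self _ _
  have hgrow (n) : (1 + ε) ^ n ≤ ((L ^ n).card : ℝ) := by
    induction n with
    | zero => simp
    | succ n ih =>
      obtain ⟨k, hk, hlt⟩ := hne (L ^ n) ⟨1, Finset.one_mem_pow hL1⟩
      have hsub : L ^ n ∪ ((L ^ n).filter fun s => k * s ∉ L ^ n).image (fun s => k * s) ⊆
          L ^ (n + 1) := by
        refine Finset.union_subset (Finset.pow_subset_pow_right hL1 n.le_succ) ?_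
        intro x hx
        obtain ⟨s, hs, rfl⟩ := Finset.mem_image.1 hx
        rw [pow_succ']
        exact Finset.mul_mem_mul (Finset.mem_insert_of_mem hk) (Finset.mem_filter.1 hs).1
      have hcard := Finset.card_le_card hsub
      rw [Finset.card_union_of_disjoint, Finset.card_image_of_injective _ (mul_right_injective k)]
        at hcard
      · have hcard' : ((L ^ n).card : ℝ) + ((L ^ n).filter fun s => k * s ∉ L ^ n).card ≤
            (L ^ (n + 1)).card := by exact_mod_cast hcard
        calc (1 + ε) ^ (n + 1) = (1 + ε) * (1 + ε) ^ n := pow_succ' _ _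
          _ ≤ (1 + ε) * (L ^ n).card := by gcongr
          _ ≤ _ := by linarith
      · refine Finset.disjoint_left.2 fun x hx hx' => ?_
        obtain ⟨s, hs, rfl⟩ := Finset.mem_image.1 hx'
        exact (Finset.mem_filter.1 hs).2 hx
  have hlim := (tendsto_pow_const_div_const_pow_of_one_lt L.card
    (show (1 : ℝ) < 1 + ε by linarith)).comp (Filter.tendsto_add_atTop_nat 1)
  obtain ⟨n, hn⟩ := (hlim.eventually_lt_const (show (0 : ℝ) < (1 + ε)⁻¹ by positivity)).exists
  have hpos : (0 : ℝ) < (1 + ε) ^ n := by positivity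
  have hle : (1 + ε) ^ n ≤ ((n : ℝ) + 1) ^ L.card :=
    (hgrow n).trans (by exact_mod_cast card_pow_le_of_comm L n)
  simp only [Function.comp_apply, Nat.cast_add, Nat.cast_one] at hn
  rw [div_lt_iff₀ (by positivity), pow_succ', inv_mul_cancel_left₀ (by positivity)] at hn
  exact hle.not_gt hn

/-- An extension of amenable groups is amenable: the product of lifts of a Følner set of the
quotient with a Følner set of the kernel is a Følner set, if the latter is almost invariant under
the finitely many elements of the kernel by which the lifts fail to be multiplicative. -/
theorem isAmenable_of_extension {G Q : Type*} [Group G] [Group Q] (f : G →* Q)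
    (hf : Function.Surjective f) (hQ : IsAmenable Q) (hker : IsAmenable f.ker) : IsAmenable G := by
  classical
  refine isAmenable_of_exists_card_boundary_le fun K ε hε => ?_
  obtain ⟨T, hT, hTb⟩ := hQ.exists_card_boundary_le (K.image f) (half_pos hε)
  let σ : Q → G := Function.surjInv hf
  have hσ (t) : f (σ t) = t := Function.surjInv_eq hf t
  let c : G → Q → f.ker := fun k t => ⟨(σ (f k * t))⁻¹ * (k * σ t), by
    rw [MonoidHom.mem_ker, map_mul, map_inv, map_mul, hσ, hσ, inv_mul_cancel]⟩
  have hc (k : G) (t : Q) (m : f.ker) : k * (σ t * m) = σ (f k * t) * (c k t * m : f.ker) := by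
    simp [c, mul_assoc]
  obtain ⟨F, hF, hFb⟩ := hker.exists_card_boundary_le ((K ×ˢ T).image fun p => c p.1 p.2)
    (half_pos hε)
  let j : Q × f.ker → G := fun p => σ p.1 * p.2
  have hj : Function.Injective j := by
    rintro ⟨t, m⟩ ⟨t', m'⟩ h
    have ht : t = t' := by
      have := congrArg f h
      simpa [j, hσ, MonoidHom.mem_ker.1 m.2, MonoidHom.mem_ker.1 m'.2] using this
    subst ht
    exact Prod.ext rfl (Subtype.ext (mul_left_cancel h))
  refine ⟨(T ×ˢ F).image j, (hT.product hF).image j, fun k hk => ?_⟩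
  rw [Finset.card_image_of_injective _ hj, Finset.card_product, Finset.filter_image]
  let D : Finset Q := T.filter fun t => f k * t ∉ T
  let E : Q → Finset f.ker := fun t => F.filter fun m => c k t * m ∉ F
  have hsub : ((T ×ˢ F).filter fun p => k * j p ∉ (T ×ˢ F).image j) ⊆
      D ×ˢ F ∪ T.biUnion fun t => {t} ×ˢ E t := by
    rintro ⟨t, m⟩ hp
    obtain ⟨hp, hp'⟩ := Finset.mem_filter.1 hp
    obtain ⟨ht, hm⟩ := Finset.mem_product.1 hp
    by_cases h1 : f k * t ∈ T
    · refine Finset.mem_union_right _ (Finset.mem_biUnion.2 ⟨t, ht, Finset.mem_product.2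
        ⟨Finset.mem_singleton_self t, Finset.mem_filter.2 ⟨hm, fun h2 => hp' ?_⟩⟩⟩)
      exact Finset.mem_image.2
        ⟨(f k * t, c k t * m), Finset.mem_product.2 ⟨h1, h2⟩, (hc k t m).symm⟩
    · exact Finset.mem_union_left _ (Finset.mem_product.2 ⟨Finset.mem_filter.2 ⟨ht, h1⟩, hm⟩)
  have hcard : (((T ×ˢ F).filter fun p => k * j p ∉ (T ×ˢ F).image j).image j).card ≤
      D.card * F.card + ∑ t ∈ T, (E t).card := by
    have hE : (T.biUnion fun t => {t} ×ˢ E t).card ≤ ∑ t ∈ T, (E t).card := by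
      refine Finset.card_biUnion_le.trans (Finset.sum_le_sum fun t _ => ?_)
      rw [Finset.card_product, Finset.card_singleton, one_mul]
    have hD : (D ×ˢ F).card = D.card * F.card := Finset.card_product _ _
    have h := (Finset.card_le_card hsub).trans (Finset.card_union_le _ _)
    rw [hD] at h
    exact Finset.card_image_le.trans (h.trans (add_le_add le_rfl hE))
  have h1 : (D.card : ℝ) ≤ ε / 2 * T.card := hTb (f k) (Finset.mem_image_of_mem f hk)
  have hEt (t) (ht : t ∈ T) : ((E t).card : ℝ) ≤ ε / 2 * F.card :=
    hFb (c k t) (Finset.mem_image.2 ⟨(k, t), Finset.mem_product.2 ⟨hk, ht⟩, rfl⟩)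
  have h2 : ∑ t ∈ T, ((E t).card : ℝ) ≤ T.card * (ε / 2 * F.card) := by
    rw [← nsmul_eq_mul]
    exact Finset.sum_le_card_nsmul _ _ _ hEt
  refine (Nat.cast_le.2 hcard).trans ?_
  rw [Nat.cast_add, Nat.cast_mul, Nat.cast_sum, Nat.cast_mul]
  calc (D.card : ℝ) * F.card + ∑ t ∈ T, ((E t).card : ℝ)
      ≤ ε / 2 * T.card * F.card + T.card * (ε / 2 * F.card) :=
        add_le_add (mul_le_mul_of_nonneg_right h1 (Nat.cast_nonneg _)) h2
    _ = ε * (T.card * F.card) := by ring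

theorem isAmenable_of_isNilpotent (G : Type*) [Group G] [hG : Group.IsNilpotent G] :
    IsAmenable G := by
  refine Group.nilpotent_center_quotient_ind (P := fun G _ _ => IsAmenable G) G
    (fun G _ _ => isAmenable_of_comm fun a b => Subsingleton.elim _ _) fun G _ _ ih => ?_
  refine isAmenable_of_extension (QuotientGroup.mk' (Subgroup.center G))
    (QuotientGroup.mk'_surjective _) ih (isAmenable_of_comm fun a b => Subtype.ext ?_)
  have ha := a.2
  exact (Subgroup.mem_center_iff.1 ((QuotientGroup.eq_one_iff _).1 ha) b).symm

theorem isAmenable_wreathProduct {A Λ : Type*} [AddCommGroup A] [Group Λ] (hΛ : IsAmenable Λ) :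
    IsAmenable (WreathProduct A Λ) := by
  refine isAmenable_of_extension SemidirectProduct.rightHom SemidirectProduct.rightHom_surjective hΛ
    (isAmenable_of_comm fun a b => Subtype.ext (SemidirectProduct.ext ?_ ?_))
  · have ha : a.1.right = 1 := a.2
    have hb : b.1.right = 1 := b.2
    simp [ha, hb, mul_comm]
  · have ha : a.1.right = 1 := a.2
    have hb : b.1.right = 1 := b.2
    simp [ha, hb]

end Amenable

/-! ### Residual finiteness of finitely generated nilpotent groups -/

section Nilpotent

open scoped commutatorElement

theorem Subgroup.fg_of_fg_map_of_fg_inf_ker {G Q : Type*} [Group G] [Group Q] (f : G →* Q)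
    {H : Subgroup G} (hmap : (H.map f).FG) (hker : (H ⊓ f.ker).FG) : H.FG := by
  obtain ⟨S, hS, hSfin⟩ := (Subgroup.fg_iff _).1 hmap
  have hsurj : Set.SurjOn f H S := fun s hs => by
    have : s ∈ H.map f := hS ▸ Subgroup.subset_closure hs
    exact this
  obtain ⟨S', hS'H, hS'⟩ := hsurj.exists_bijOn_subset
  have hS'fin : S'.Finite := hS'.finite_iff_finite.2 hSfin
  have heq : H = Subgroup.closure S' ⊔ (H ⊓ f.ker) := by
    refine le_antisymm (fun h hh => ?_) (sup_le ((Subgroup.closure_le _).2 hS'H) inf_le_left)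
    have hfh : f h ∈ (Subgroup.closure S').map f := by
      rw [MonoidHom.map_closure, hS'.image_eq, hS]
      exact Subgroup.mem_map_of_mem f hh
    obtain ⟨k, hk, hkh⟩ := hfh
    have hkH : k ∈ H := (Subgroup.closure_le _).2 hS'H hk
    rw [← mul_inv_cancel_left k h]
    refine Subgroup.mul_mem_sup hk ⟨H.mul_mem (H.inv_mem hkH) hh, ?_⟩
    change f (k⁻¹ * h) = 1
    rw [map_mul, map_inv, hkh, inv_mul_cancel]
  rw [heq]
  exact Subgroup.FG.sup ((Subgroup.fg_iff _).2 ⟨S', rfl, hS'fin⟩) hker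

theorem CommGroup.subgroup_fg {G : Type*} [CommGroup G] [Group.FG G] (H : Subgroup G) : H.FG := by
  have : Module.Finite ℤ (Additive G) := Module.Finite.iff_addGroup_fg.2 inferInstance
  have hfg : (AddSubgroup.toIntSubmodule (Subgroup.toAddSubgroup H)).FG :=
    IsNoetherian.noetherian _
  rw [Subgroup.fg_iff_add_fg]
  exact (Submodule.fg_iff_addSubgroup_fg _).1 hfg

theorem Subgroup.fg_of_le_center {G : Type*} [Group G] {Z L : Subgroup G} (hZ : Z.FG)
    (hZc : Z ≤ Subgroup.center G) (hL : L ≤ Z) : L.FG := by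
  let _ : CommGroup Z :=
    { (inferInstance : Group Z) with
      mul_comm := fun a b => Subtype.ext (Subgroup.mem_center_iff.1 (hZc a.2) b).symm }
  have : Group.FG Z := (Group.fg_iff_subgroup_fg Z).2 hZ
  obtain ⟨S, hS, hSfin⟩ := (Subgroup.fg_iff _).1 (CommGroup.subgroup_fg (L.subgroupOf Z))
  refine (Subgroup.fg_iff _).2 ⟨Z.subtype '' S, ?_, hSfin.image _⟩
  rw [← MonoidHom.map_closure, hS, Subgroup.subgroupOf_map_subtype, inf_eq_left.2 hL]

/-- Modulo the next term, each term of the lower central series of a finitely generated group is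
generated by finitely many elements, namely by commutators of generators of the previous term with
generators of the group. -/
theorem exists_finite_closure_sup_lowerCentralSeries {G : Type*} [Group G] [hG : Group.FG G]
    (n : ℕ) : ∃ S : Set G, S.Finite ∧ (⊤ : Subgroup G).lowerCentralSeries n =
      Subgroup.closure S ⊔ (⊤ : Subgroup G).lowerCentralSeries (n + 1) := by
  obtain ⟨T, hT, hTfin⟩ := Group.fg_iff.1 hG
  induction n with
  | zero =>
    refine ⟨T, hTfin, ?_⟩
    rw [hT, top_sup_eq]
    rfl
  | succ n ih =>
    obtain ⟨S, hSfin, hS⟩ := ih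
    let γ : ℕ → Subgroup G := (⊤ : Subgroup G).lowerCentralSeries
    have hsucc (k) : γ (k + 1) = ⁅γ k, ⊤⁆ := Subgroup.lowerCentralSeries_succ _ _
    have hanti : γ (n + 2) ≤ γ (n + 1) := Subgroup.lowerCentralSeries_antitone _ (n + 1).le_succ
    let S' : Set G := Set.image2 (fun s t => ⁅s, t⁆) S T
    let K : Subgroup G := Subgroup.closure S' ⊔ γ (n + 2)
    have hSγ : S ⊆ γ n := fun s hs => by
      change s ∈ (⊤ : Subgroup G).lowerCentralSeries n
      rw [hS]
      exact Subgroup.mem_sup_left (Subgroup.subset_closure hs)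
    have hKle : K ≤ γ (n + 1) := by
      refine sup_le ((Subgroup.closure_le _).2 ?_) hanti
      rintro _ ⟨s, hs, t, -, rfl⟩
      rw [hsucc]
      exact Subgroup.commutator_mem_commutator (hSγ hs) (Subgroup.mem_top t)
    have hcomm {x : G} (hx : x ∈ γ (n + 1)) (y : G) : ⁅x, y⁆ ∈ K := by
      refine Subgroup.mem_sup_right ?_
      rw [hsucc]
      exact Subgroup.commutator_mem_commutator hx (Subgroup.mem_top y)
    have hKn : K.Normal := ⟨fun k hk y => by
      have h := K.mul_mem (K.inv_mem (hcomm (hKle hk) y)) hk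
      rwa [commutatorElement_inv, commutatorElement_def, inv_mul_cancel_right] at h⟩
    -- Modulo `K`, the generators of `γ n` commute with the generators of `G`, so `γ n` is central.
    have hcentral : γ n ≤ (Subgroup.center (G ⧸ K)).comap (QuotientGroup.mk' K) := by
      have hmem {x : G} : x ∈ (Subgroup.center (G ⧸ K)).comap (QuotientGroup.mk' K) ↔
          ∀ y, ⁅x, y⁆ ∈ K := by
        rw [Subgroup.mem_comap, Subgroup.mem_center_iff]
        constructor
        · intro h y
          exact (QuotientGroup.eq_one_iff _).1
            (commutatorElement_eq_one_iff_mul_comm.2 (h (y : G ⧸ K)).symm :)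
        · intro h y
          induction y using QuotientGroup.induction_on with | H y =>
          exact (commutatorElement_eq_one_iff_mul_comm.1
            ((QuotientGroup.eq_one_iff ⁅x, y⁆).2 (h y))).symm
      change (⊤ : Subgroup G).lowerCentralSeries n ≤ _
      rw [hS]
      refine sup_le ((Subgroup.closure_le _).2 fun s hs => hmem.2 ?_) fun x hx => hmem.2 (hcomm hx)
      have hcent : (⊤ : Subgroup G) ≤ (Subgroup.centralizer {(s : G ⧸ K)}).comap
          (QuotientGroup.mk' K) := by
        rw [← hT]
        refine (Subgroup.closure_le _).2 fun t ht => Subgroup.mem_centralizer_singleton_iff.2 ?_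
        have : ((⁅s, t⁆ : G) : G ⧸ K) = 1 := (QuotientGroup.eq_one_iff _).2
          (Subgroup.mem_sup_left (Subgroup.subset_closure ⟨s, hs, t, ht, rfl⟩))
        exact (commutatorElement_eq_one_iff_mul_comm.1 this).symm
      intro y
      rw [← QuotientGroup.eq_one_iff]
      exact commutatorElement_eq_one_iff_mul_comm.2
        (Subgroup.mem_centralizer_singleton_iff.1 (hcent (Subgroup.mem_top y))).symm
    refine ⟨S', hSfin.image2 _ hTfin, le_antisymm ?_ hKle⟩
    change γ (n + 1) ≤ K
    rw [hsucc, Subgroup.commutator_le]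
    intro x hx y _
    rw [← QuotientGroup.eq_one_iff]
    exact commutatorElement_eq_one_iff_mul_comm.2 ((Subgroup.mem_center_iff.1 (hcentral hx)) y).symm

/-- Finitely generated nilpotent groups satisfy the maximal condition on subgroups. -/
theorem Subgroup.fg_of_isNilpotent {G : Type u} [Group G] [Group.FG G] [hG : Group.IsNilpotent G]
    (H : Subgroup G) : H.FG := by
  obtain ⟨n, hn⟩ := Subgroup.nilpotent_iff_lowerCentralSeries.1 hG
  clear hG
  induction n generalizing G with
  | zero =>
    rw [Subgroup.lowerCentralSeries_zero] at hn
    rw [eq_bot_iff.2 (hn ▸ le_top : H ≤ ⊥)]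
    exact Subgroup.FG.bot
  | succ n ih =>
    let Z := (⊤ : Subgroup G).lowerCentralSeries n
    have hZfg : Z.FG := by
      obtain ⟨S, hSfin, hS⟩ := exists_finite_closure_sup_lowerCentralSeries (G := G) n
      rw [hn, sup_bot_eq] at hS
      exact (Subgroup.fg_iff _).2 ⟨S, hS.symm, hSfin⟩
    have hZc : Z ≤ Subgroup.center G := by
      rw [Subgroup.lowerCentralSeries_succ, Subgroup.commutator_eq_bot_iff_le_centralizer] at hn
      exact fun z hz => Subgroup.mem_center_iff.2 fun g => (hn hz g (Subgroup.mem_top g))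
    refine Subgroup.fg_of_fg_map_of_fg_inf_ker (QuotientGroup.mk' Z) (ih (G := G ⧸ Z) _ ?_) ?_
    · have htop : (⊤ : Subgroup (G ⧸ Z)) = (⊤ : Subgroup G).map (QuotientGroup.mk' Z) :=
        (Subgroup.map_top_of_surjective _ (QuotientGroup.mk'_surjective Z)).symm
      rw [htop, ← Subgroup.map_lowerCentralSeries, Subgroup.map_eq_bot_iff, QuotientGroup.ker_mk']
    · rw [QuotientGroup.ker_mk']
      exact Subgroup.fg_of_le_center hZfg hZc inf_le_right

/-- If the centre of a finitely generated group is finite, then so is the second term of the upper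
central series: an element of it is determined modulo the centre by its commutators with the
generators, which are central. -/
theorem finite_center_quotient_center {G : Type*} [Group G] [hG : Group.FG G]
    [Finite (Subgroup.center G)] : Finite (Subgroup.center (G ⧸ Subgroup.center G)) := by
  obtain ⟨T, hT, hTfin⟩ := Group.fg_iff.1 hG
  have : Finite T := hTfin
  have hmem (x : Subgroup.center (G ⧸ Subgroup.center G)) (t : G) :
      ⁅x.1.out, t⁆ ∈ Subgroup.center G := by
    refine (QuotientGroup.eq_one_iff _).1
      (commutatorElement_eq_one_iff_mul_comm.2 ?_ :
        ⁅(x.1.out : G ⧸ Subgroup.center G), (t : G ⧸ Subgroup.center G)⁆ = 1)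
    rw [QuotientGroup.out_eq']
    exact (Subgroup.mem_center_iff.1 x.2 t).symm
  refine Finite.of_injective (fun x (t : T) => (⟨⁅x.1.out, t.1⁆, hmem x t⟩ : Subgroup.center G)) ?_
  intro x y hxy
  refine Subtype.ext ?_
  rw [← QuotientGroup.out_eq' x.1, ← QuotientGroup.out_eq' y.1, QuotientGroup.eq]
  have hle : (⊤ : Subgroup G) ≤ Subgroup.centralizer {x.1.out⁻¹ * y.1.out} := by
    rw [← hT]
    refine (Subgroup.closure_le _).2 fun t ht => Subgroup.mem_centralizer_singleton_iff.2 ?_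
    have h : ⁅x.1.out, t⁆ = ⁅y.1.out, t⁆ := congrArg Subtype.val (congrFun hxy ⟨t, ht⟩)
    rw [commutatorElement_def, commutatorElement_def, mul_left_inj] at h
    calc t * (x.1.out⁻¹ * y.1.out)
        = x.1.out⁻¹ * (x.1.out * t * x.1.out⁻¹) * y.1.out := by group
      _ = x.1.out⁻¹ * y.1.out * t := by rw [h]; group
  exact Subgroup.mem_center_iff.2 fun g =>
    Subgroup.mem_centralizer_singleton_iff.1 (hle (Subgroup.mem_top g))

theorem finite_of_finite_center (G : Type*) [Group G] [hG : Group.IsNilpotent G] (hfg : Group.FG G)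
    (hfin : Finite (Subgroup.center G)) : Finite G := by
  revert hfg hfin
  refine Group.nilpotent_center_quotient_ind
    (P := fun G _ _ => Group.FG G → Finite (Subgroup.center G) → Finite G) G
    (fun G _ _ _ _ => inferInstance) fun G _ _ ih _ _ => ?_
  have := ih inferInstance finite_center_quotient_center
  exact Finite.of_equiv _ (Subgroup.groupEquivQuotientProdSubgroup (s := Subgroup.center G)).symm

/-- Finitely generated nilpotent groups are residually finite: modulo a normal subgroup that is
maximal among those not containing `g`, every nontrivial subgroup of the centre contains `g`, so
that the centre is a torsion group, hence finite, and then so is the quotient. -/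
theorem residuallyFinite_of_isNilpotent {G : Type u} [Group G] [Group.FG G] [Group.IsNilpotent G] :
    Group.ResiduallyFinite G := by
  rw [Group.residuallyFinite_iff_exists_finiteIndex]
  intro g hg
  obtain ⟨N, -, ⟨hN, hgN⟩, hmax⟩ : ∃ N : Subgroup G, ⊥ ≤ N ∧
      Maximal (fun N : Subgroup G => N.Normal ∧ g ∉ N) N := by
    refine zorn_le_nonempty₀ {N : Subgroup G | N.Normal ∧ g ∉ N} (fun c hc hchain N₀ hN₀ => ?_) ⊥
      ⟨inferInstance, fun h => hg (Subgroup.mem_bot.1 h)⟩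
    have hmem {x : G} : x ∈ sSup c ↔ ∃ N ∈ c, x ∈ N :=
      Subgroup.mem_sSup_of_directedOn ⟨N₀, hN₀⟩ hchain.directedOn
    refine ⟨sSup c, ⟨⟨fun x hx y => ?_⟩, fun h => ?_⟩, fun N hN => le_sSup hN⟩
    · obtain ⟨N, hN, hxN⟩ := hmem.1 hx
      exact hmem.2 ⟨N, hN, (hc hN).1.conj_mem x hxN y⟩
    · obtain ⟨N, hN, hgN⟩ := hmem.1 h
      exact (hc hN).2 hgN
  have hg1 : (g : G ⧸ N) ≠ 1 := fun h => hgN ((QuotientGroup.eq_one_iff g).1 h)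
  have hpow (w : G ⧸ N) (hw : w ∈ Subgroup.center (G ⧸ N)) (hw1 : w ≠ 1) :
      (g : G ⧸ N) ∈ Subgroup.zpowers w := by
    by_contra hgw
    have hle : N ≤ (Subgroup.zpowers w).comap (QuotientGroup.mk' N) := by
      rw [← Subgroup.map_le_iff_le_comap,
        (Subgroup.map_eq_bot_iff _).2 (QuotientGroup.ker_mk' N).ge]
      exact bot_le
    have hnormal : (Subgroup.zpowers w).Normal :=
      ⟨fun x hx y => by
        rw [Subgroup.mem_center_iff.1 (Subgroup.zpowers_le.2 hw hx) y, mul_inv_cancel_right]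
        exact hx⟩
    have hge := hmax ⟨hnormal.comap (QuotientGroup.mk' N), hgw⟩ hle
    obtain ⟨x, rfl⟩ := QuotientGroup.mk_surjective w
    exact hw1 ((QuotientGroup.eq_one_iff x).2 (hge (Subgroup.mem_zpowers (x : G ⧸ N))))
  let _ : CommGroup (Subgroup.center (G ⧸ N)) :=
    { (inferInstance : Group (Subgroup.center (G ⧸ N))) with
      mul_comm := fun a b => Subtype.ext (Subgroup.mem_center_iff.1 a.2 b).symm }
  have htors : IsMulTorsion (Subgroup.center (G ⧸ N)) := by
    rintro ⟨w, hw⟩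
    rw [← Submonoid.isOfFinOrder_coe]
    change IsOfFinOrder w
    rw [isOfFinOrder_iff_zpow_eq_one]
    by_contra! hinf
    have hw1 : w ≠ 1 := fun h => hinf 1 one_ne_zero (by simp [h])
    obtain ⟨k, hk⟩ := Subgroup.mem_zpowers_iff.1 (hpow w hw hw1)
    have hk0 : k ≠ 0 := fun h => hg1 (by rw [← hk, h, zpow_zero])
    have hw2 : w ^ (k * 2) ≠ 1 := hinf _ (mul_ne_zero hk0 two_ne_zero)
    obtain ⟨j, hj⟩ := Subgroup.mem_zpowers_iff.1
      (hpow _ ((Subgroup.center _).zpow_mem hw (k * 2)) hw2)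
    refine hinf (k * (2 * j - 1)) (mul_ne_zero hk0 (by omega)) ?_
    rw [mul_sub, mul_one, zpow_sub, ← mul_assoc, zpow_mul, hj, hk, mul_inv_cancel]
  have : Group.FG (Subgroup.center (G ⧸ N)) :=
    (Group.fg_iff_subgroup_fg _).2 (Subgroup.fg_of_isNilpotent _)
  have hfin : Finite (Subgroup.center (G ⧸ N)) := CommGroup.finite_of_fg_isMulTorsion _ htors
  have := finite_of_finite_center (G ⧸ N) inferInstance hfin
  exact ⟨N, Subgroup.finiteIndex_of_finite_quotient, hgN⟩

end Nilpotent

/-! ### The action of the wreath product -/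

section Action

open MeasureTheory Filter

/-- Enumerate `Λ` and let `E m` consist of its first `m` elements. Choosing `N m` so as to separate
the first `m * 2 ^ (m + 2)` elements of `Λ` makes its index large compared to `E m`. -/
theorem exists_normal_sequence (Λ : Type*) [Group Λ] [Infinite Λ] [Countable Λ]
    [Group.ResiduallyFinite Λ] :
    ∃ (N : ℕ → Subgroup Λ) (E : ℕ → Finset Λ), (∀ m, (N m).Normal) ∧ (∀ m, (N m).FiniteIndex) ∧
      (∀ S : Finset Λ, ∀ᶠ m in atTop, Set.InjOn (fun x : Λ => (x : Λ ⧸ N m)) S) ∧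
      (∀ x, ∀ᶠ m in atTop, x ∈ E m) ∧ ∀ m, (E m).card * 2 ^ (m + 2) ≤ (N m).index := by
  classical
  obtain ⟨_⟩ := nonempty_denumerable Λ
  let x : ℕ ≃ Λ := (Denumerable.eqv Λ).symm
  choose N hN hfin hinj using fun m : ℕ =>
    exists_normal_injOn ((Finset.range (m * 2 ^ (m + 2))).image x)
  have hle (m : ℕ) : m ≤ m * 2 ^ (m + 2) := Nat.le_mul_of_pos_right m (by positivity)
  refine ⟨N, fun m => (Finset.range m).image x, hN, hfin, fun S => ?_, fun y => ?_, fun m => ?_⟩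
  · filter_upwards [eventually_gt_atTop (S.sup x.symm)] with m hm
    refine (hinj m).mono fun y hy => ?_
    rw [Finset.coe_image]
    refine ⟨x.symm y, Finset.mem_coe.2 (Finset.mem_range.2 ?_), x.apply_symm_apply y⟩
    exact ((Finset.le_sup (f := x.symm) hy).trans_lt hm).trans_le (hle m)
  · filter_upwards [eventually_gt_atTop (x.symm y)] with m hm
    exact Finset.mem_image.2 ⟨x.symm y, Finset.mem_range.2 hm, x.apply_symm_apply y⟩
  · rw [Finset.card_image_of_injective _ x.injective, Finset.card_range]
    have := hfin m
    have := Fintype.ofFinite (Λ ⧸ N m)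
    have h := Finset.card_le_univ (((Finset.range (m * 2 ^ (m + 2))).image x).image
      fun y : Λ => (y : Λ ⧸ N m))
    rw [Finset.card_image_of_injOn (hinj m), Finset.card_image_of_injective _ x.injective,
      Finset.card_range, ← Nat.card_eq_fintype_card] at h
    exact h

/-- The odometer of `A ≀ Λ` attached to the subgroups `wreathSubgroup (N m) (E m) (B m)`. -/
theorem exists_wreathProduct_action (A Λ : Type*) [AddCommGroup A] [Nontrivial A] [Countable A]
    [Group Λ] [Infinite Λ] [Countable Λ] [Group.ResiduallyFinite Λ] (B : ℕ → AddSubgroup A)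
    [∀ m, (B m).FiniteIndex] (hB : ∀ a, a ≠ 0 → ∀ᶠ m in atTop, a ∉ B m) :
    ∃ _ : MulAction (WreathProduct A Λ) (ℕ → Bool),
      ContinuousConstSMul (WreathProduct A Λ) (ℕ → Bool) ∧
      MulAction.IsMinimal (WreathProduct A Λ) (ℕ → Bool) ∧
      IsTopologicallyFree (WreathProduct A Λ) (ℕ → Bool) ∧
      (∃ μ : Measure (ℕ → Bool), invariantMeasures (WreathProduct A Λ) (ℕ → Bool) = {μ} ∧
        ergodicMeasures (WreathProduct A Λ) (ℕ → Bool) = {μ}) ∧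
      HasComparison (WreathProduct A Λ) (ℕ → Bool) ∧
      ¬ IsAlmostFinite (WreathProduct A Λ) (ℕ → Bool) := by
  obtain ⟨N, E, hN, hfin, hinj, hE, hcard⟩ := exists_normal_sequence Λ
  have hbot (g : WreathProduct A Λ)
      (hg : ∀ m, g ∈ wreathSubgroup (N m) (E m : Set Λ) (B m)) : g = 1 :=
    eq_one_of_forall_mem_wreathSubgroup hinj hE hB hg
  have : Infinite (WreathProduct A Λ) :=
    Infinite.of_injective _ (SemidirectProduct.inr_injective (φ := shiftHom A Λ))
  have : Countable (Multiplicative (Λ →₀ A)) := inferInstanceAs (Countable (Λ →₀ A))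
  have : Countable (WreathProduct A Λ) := SemidirectProduct.equivProd.injective.countable
  have hfinG (m) : (wreathSubgroup (N m) (E m : Set Λ) (B m)).FiniteIndex :=
    finiteIndex_wreathSubgroup _ _ _
  obtain ⟨H, hH, h0, hHfin, hle, hmem⟩ := exists_strictAnti_chain _ hbot
  obtain ⟨_, π, hodo, ⟨x₀, hx₀⟩, μ, hμ⟩ := exists_odometer hH h0
  have hcont := hodo.continuousConstSMul
  have hHbot (g) (hg : ∀ n, g ∈ H n) : g = 1 :=
    hbot g fun m => (hle m).elim fun n hn => hn (hg n)
  have huniq : invariantMeasures (WreathProduct A Λ) (ℕ → Bool) = {μ} :=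
    hodo.invariantMeasures_subsingleton.eq_singleton_of_mem hμ
  obtain ⟨v, hv⟩ := exists_ne (0 : A)
  refine ⟨inferInstance, hcont, hodo.isMinimal, hodo.isTopologicallyFree hHbot hx₀,
    ⟨μ, huniq, ergodicMeasures_eq_of_unique huniq⟩, hodo.hasComparison ⟨μ, hμ⟩,
    not_isAlmostFinite_of_fixedPoints hμ
      (measure_fixedPoints_ne_zero hodo hle hmem hcard v hμ) fun h => hv ?_⟩
  have := congrArg (fun g : WreathProduct A Λ => g.left.toAdd 1) h
  simpa using this

/-- The vectors in `ℤ^d` that are divisible by `k`. -/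
def divisibleVectors (d k : ℕ) : AddSubgroup (Fin d → ℤ) :=
  ((Int.castAddHom (ZMod k)).compLeft (Fin d)).ker

theorem finiteIndex_divisibleVectors (d k : ℕ) [NeZero k] : (divisibleVectors d k).FiniteIndex :=
  AddSubgroup.finiteIndex_ker _

theorem eventually_notMem_divisibleVectors {d : ℕ} {a : Fin d → ℤ} (ha : a ≠ 0) :
    ∀ᶠ m in atTop, a ∉ divisibleVectors d (2 ^ m) := by
  obtain ⟨j, hj⟩ := Function.ne_iff.1 ha
  filter_upwards [eventually_ge_atTop (a j).natAbs] with m hm hmem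
  have h : ((a j : ℤ) : ZMod (2 ^ m)) = 0 := congrFun (AddMonoidHom.mem_ker.1 hmem) j
  rw [ZMod.intCast_zmod_eq_zero_iff_dvd, Int.natCast_dvd] at h
  exact (Nat.le_of_dvd (Int.natAbs_pos.2 hj) h).not_gt (hm.trans_lt m.lt_two_pow_self)

theorem wreathProduct_isAmenable_and_exists_action (Λ : Type u) [Group Λ] [Nontrivial Λ]
    [Group.FG Λ] [Group.IsNilpotent Λ]
    (htf : ∀ g : Λ, IsOfFinOrder g → g = 1) (d : ℕ) (hd : 1 ≤ d) :
    IsAmenable (WreathProduct (Fin d → ℤ) Λ) ∧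
      ∃ _ : MulAction (WreathProduct (Fin d → ℤ) Λ) (ℕ → Bool),
        ContinuousConstSMul (WreathProduct (Fin d → ℤ) Λ) (ℕ → Bool) ∧
        MulAction.IsMinimal (WreathProduct (Fin d → ℤ) Λ) (ℕ → Bool) ∧
        IsTopologicallyFree (WreathProduct (Fin d → ℤ) Λ) (ℕ → Bool) ∧
        (∃ μ : Measure (ℕ → Bool),
          invariantMeasures (WreathProduct (Fin d → ℤ) Λ) (ℕ → Bool) = {μ} ∧
          ergodicMeasures (WreathProduct (Fin d → ℤ) Λ) (ℕ → Bool) = {μ}) ∧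
        HasComparison (WreathProduct (Fin d → ℤ) Λ) (ℕ → Bool) ∧
        ¬ IsAlmostFinite (WreathProduct (Fin d → ℤ) Λ) (ℕ → Bool) := by
  have : Infinite Λ := by
    obtain ⟨g, hg⟩ := exists_ne (1 : Λ)
    by_contra hfin
    rw [not_infinite_iff_finite] at hfin
    exact hg (htf g (isOfFinOrder_of_finite g))
  have : Countable Λ := by
    obtain ⟨T, _, φ, hφ⟩ := Group.fg_iff_exists_freeGroup_hom_surjective_finite.1 ‹Group.FG Λ›
    exact hφ.countable
  have := residuallyFinite_of_isNilpotent (G := Λ)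
  have : Nonempty (Fin d) := ⟨⟨0, hd⟩⟩
  have (m : ℕ) : (divisibleVectors d (2 ^ m)).FiniteIndex := finiteIndex_divisibleVectors d _
  exact ⟨isAmenable_wreathProduct (isAmenable_of_isNilpotent Λ),
    exists_wreathProduct_action (Fin d → ℤ) Λ (fun m => divisibleVectors d (2 ^ m))
      fun a => eventually_notMem_divisibleVectors⟩

end Action

/-- The wreath product `ℤ ≀ ℤ` is a counterexample; `ℤ` is lifted to the given universe. -/
theorem not_topologicallyFreeTomsWinter : ¬ TopologicallyFreeTomsWinter.{u} := by
  intro h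
  let Λ : Type u := ULift (Multiplicative ℤ)
  have : Group.FG Λ := Group.fg_of_surjective
    (f := (MulEquiv.ulift : ULift.{u} (Multiplicative ℤ) ≃* _).symm.toMonoidHom)
    MulEquiv.ulift.symm.surjective
  have htf (g : Λ) (hg : IsOfFinOrder g) : g = 1 := by
    have h' : IsOfFinOrder g.down :=
      (MulEquiv.ulift : Λ ≃* Multiplicative ℤ).toMonoidHom.isOfFinOrder hg
    obtain ⟨n, hn, hgn⟩ := isOfFinOrder_iff_pow_eq_one.1 h'
    have h0 : n • g.down.toAdd = 0 := congrArg Multiplicative.toAdd hgn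
    exact ULift.ext _ _ ((smul_eq_zero.1 h0).resolve_left hn.ne')
  obtain ⟨ham, _, hcont, hmin, hfree, ⟨μ, -, herg⟩, hcomp, haf⟩ :=
    wreathProduct_isAmenable_and_exists_action Λ htf 1 le_rfl
  have : Countable Λ := inferInstance
  have : Countable (Multiplicative (Λ →₀ (Fin 1 → ℤ))) :=
    inferInstanceAs (Countable (Λ →₀ (Fin 1 → ℤ)))
  have : Countable (WreathProduct (Fin 1 → ℤ) Λ) := SemidirectProduct.equivProd.injective.countable
  exact haf ((h (WreathProduct (Fin 1 → ℤ) Λ) (ℕ → Bool) ham hmin hfree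
    (herg ▸ Set.finite_singleton μ)).2 hcomp)

theorem mainTheorem5 :
    (∀ (Λ : Type u) [Group Λ] [Nontrivial Λ] [Group.FG Λ] [Group.IsNilpotent Λ]
      (_ : ∀ g : Λ, IsOfFinOrder g → g = 1) (d : ℕ) (_ : 1 ≤ d),
      IsAmenable (WreathProduct (Fin d → ℤ) Λ) ∧
      ∃ (X : Type) (_ : TopologicalSpace X) (_ : MeasurableSpace X) (_ : BorelSpace X)
        (_ : MulAction (WreathProduct (Fin d → ℤ) Λ) X),
        Nonempty (X ≃ₜ (ℕ → Bool)) ∧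
        ContinuousConstSMul (WreathProduct (Fin d → ℤ) Λ) X ∧
        MulAction.IsMinimal (WreathProduct (Fin d → ℤ) Λ) X ∧
        IsTopologicallyFree (WreathProduct (Fin d → ℤ) Λ) X ∧
        (∃ μ : MeasureTheory.Measure X,
          invariantMeasures (WreathProduct (Fin d → ℤ) Λ) X = {μ} ∧
          ergodicMeasures (WreathProduct (Fin d → ℤ) Λ) X = {μ}) ∧
        HasComparison (WreathProduct (Fin d → ℤ) Λ) X ∧
        ¬ IsAlmostFinite (WreathProduct (Fin d → ℤ) Λ) X) ∧
    ¬ TopologicallyFreeTomsWinter.{u} := by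
  refine ⟨fun Λ _ _ _ _ htf d hd => ?_, not_topologicallyFreeTomsWinter⟩
  obtain ⟨ham, act, h⟩ := wreathProduct_isAmenable_and_exists_action Λ htf d hd
  exact ⟨ham, ℕ → Bool, inferInstance, inferInstance, inferInstance, act, ⟨Homeomorph.refl _⟩, h⟩
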